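/- **Quantum-accelerated estimation of a neural network loss function.** *Setting.* Let $f_{NN}:\mathbb R^d\to\mathbb R$ (a classical network together with its scalar loss) be Lipschitz with constant $L\ge 0$, i.e. $|f_{NN}(x)-f_{NN}(y)|\le L\|x-y\|_2$ for all $x,y$. Let $X$ be a random vector in $\mathbb R^d$ that takes the value $X_i$ with probability $p_i$, where $i$ runs over the $n$-bit strings. The network is available as the unitary $U_{NN}|i\rangle|y\rangle=|i\rangle|y\oplus \hat f(i)\rangle$, where $\hat f(i)$ is a fixed-point number (sign bit, $c_1$ integer bits, $c_2$ fractional bits) with $|\hat f(i)-f_{NN}(X_i)|\le\varepsilon/2$ whenever $p_i>0$ (in particular, exact values are allowed). The distribution of $X$ is available as a unitary $U_p$ with $U_p|0\cdots0\rangle=\sum_i\sqrt{p_i}\,|i\rangle$. A quantum query algorithm is a circuit on the input register, the fixed-point register and finitely many ancilla qubits, started in $|0\cdots 0\rangle$; it consists of fixed unitaries (independent of the queried unitaries) and of queries to $U_{NN}$ (which is its own inverse), $U_p$ and $U_p^\dagger$; it ends with a measurement in the computational basis, and a real number is computed from the outcome. *Claim.* There are absolute constants $C>0$ and $m\in\mathbb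 N$ such that the following holds for all $n,c_1,c_2\in\mathbb N$, all $L,B,M\ge0$ and all $\varepsilon>0$. Put $\Lambda=(L+B^2)(1+M)$. 1. There is a quantum query algorithm, depending only on $n,c_1,c_2,L,B,M,\varepsilon$, that makes at most $$C\Bigl(1+\frac{\Lambda}{\varepsilon}\Bigr)\Bigl(1+\log\Bigl(1+\frac{\Lambda}{\varepsilon}\Bigr)\Bigr)^m=\tilde O\!\left(\frac{(L+B^2)(1+M)}{\varepsilon}\right)\qquad(\text{for }\Lambda\ge\varepsilon)$$ queries to $U_{NN}$, and at most as many queries to $U_p$ and $U_p^\dagger$ together, such that for every $d$, $f_{NN}$, $X$, $\hat f$ and $U_p$ as above with $|f_{NN}(0)|\le B$ and $\mathbb E\|X\|_2^2\le M$, its output $w$ satisfies $|w-\mathbb E f_{NN}(X)|\le\varepsilon$ with probability at least $0.99$. (With $B=|f_{NN}(0)|$ and $M=\mathbb E\|X\|_2^2$ the number of queries is $\tilde O((L+|f_{NN}(0)|^2)(1+\mathbb E\|X\|_2^2)/\varepsilon)$.) 2. This is a quadratic improvement over the classical Monte Carlo guarantee, which reads: for all $d$, $f_{NN}$, $X$,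 $\hat f$ as in 1, the average of the outputs $\hat f$ on $k$ independent samples of $X$ is within $\varepsilon$ of $\mathbb E f_{NN}(X)$ with probability at least $0.99$ as soon as $k\ge C(1+\Lambda/\varepsilon)^2$. If $\Lambda\ge1$, both parts also hold when $L$ is instead a Lipschitz constant for squared distances, i.e. when the Lipschitz hypothesis is $|f_{NN}(x)-f_{NN}(y)|^2\le L\|x-y\|_2^2$ for all $x,y$. -/

import Mathlib

open scoped Kronecker Matrix

noncomputable section

namespace QAMC

/-! ### Registers and fixed-point numbers -/

/-- Bit strings of length `n`, the computational basis labels of `n` qubits. -/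
abbrev Bits (n : ℕ) : Type := Fin n → Bool

/-- The all-zero string. -/
def Bits.zero (n : ℕ) : Bits n := fun _ => false

/-- Fixed-point words: a sign bit `s`, integer bits `a`, and fractional bits `b`. -/
abbrev FixedPoint (c₁ c₂ : ℕ) : Type := Bool × Bits c₁ × Bits c₂

/-- The all-zero word. -/
def FixedPoint.zero (c₁ c₂ : ℕ) : FixedPoint c₁ c₂ := (false, Bits.zero c₁, Bits.zero c₂)

/-- The number `(-1)^s (∑ᵢ 2^i aᵢ + ∑ⱼ 2^{-(j+1)} bⱼ)` that a fixed-point word stands for. -/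
def FixedPoint.value {c₁ c₂ : ℕ} (y : FixedPoint c₁ c₂) : ℝ :=
  (-1 : ℝ) ^ y.1.toNat *
    (∑ i : Fin c₁, (2 : ℝ) ^ (i : ℕ) * (y.2.1 i).toNat +
      ∑ j : Fin c₂, ((2 : ℝ) ^ ((j : ℕ) + 1))⁻¹ * (y.2.2 j).toNat)

/-- Bitwise exclusive or of fixed-point words. -/
def FixedPoint.xor {c₁ c₂ : ℕ} (y z : FixedPoint c₁ c₂) : FixedPoint c₁ c₂ :=
  (Bool.xor y.1 z.1, fun i => Bool.xor (y.2.1 i) (z.2.1 i), fun j => Bool.xor (y.2.2 j) (z.2.2 j))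

theorem FixedPoint.xor_xor_cancel {c₁ c₂ : ℕ} (y z : FixedPoint c₁ c₂) :
    FixedPoint.xor (FixedPoint.xor y z) z = y := by
  obtain ⟨s, a, b⟩ := y
  simp [FixedPoint.xor]

/-! ### The two unitaries that an algorithm can query -/

/-- The unitary `U_g |x⟩|y⟩ = |x⟩|y ⊕ g x⟩` giving access to a classical function `g`. -/
def accessUnitary {n c₁ c₂ : ℕ} (g : Bits n → FixedPoint c₁ c₂) :
    Matrix (Bits n × FixedPoint c₁ c₂) (Bits n × FixedPoint c₁ c₂) ℂ :=
  Matrix.of fun i j => if i = (j.1, FixedPoint.xor j.2 (g j.1)) then 1 else 0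

theorem accessUnitary_mulVec_single {n c₁ c₂ : ℕ} (g : Bits n → FixedPoint c₁ c₂)
    (x : Bits n) (y : FixedPoint c₁ c₂) :
    accessUnitary g *ᵥ Pi.single (x, y) 1 = Pi.single (x, FixedPoint.xor y (g x)) 1 := by
  ext i
  simp [accessUnitary, Pi.single_apply]

theorem accessUnitary_mem {n c₁ c₂ : ℕ} (g : Bits n → FixedPoint c₁ c₂) :
    accessUnitary g ∈ Matrix.unitaryGroup (Bits n × FixedPoint c₁ c₂) ℂ := by
  rw [Matrix.mem_unitaryGroup_iff']
  ext ⟨x, y⟩ ⟨x', y'⟩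
  have key : (x', FixedPoint.xor y' (g x')) = (x, FixedPoint.xor y (g x)) ↔
      (x, y) = (x', y') := by
    constructor
    · intro h
      obtain ⟨h1, h2⟩ := Prod.mk.inj h
      subst h1
      rw [← FixedPoint.xor_xor_cancel y (g x'), ← h2, FixedPoint.xor_xor_cancel]
    · intro h
      obtain ⟨h1, h2⟩ := Prod.mk.inj h
      rw [h1, h2]
  simp only [Matrix.mul_apply, Matrix.star_apply, accessUnitary, Matrix.of_apply, apply_ite star,
    star_one, star_zero, ite_mul, one_mul, zero_mul, Finset.sum_ite_eq',
    Finset.mem_univ, if_true, Matrix.one_apply]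
  by_cases h : (x, y) = (x', y')
  · rw [if_pos h, if_pos (key.2 h).symm]
  · rw [if_neg h, if_neg (fun h' => h (key.1 h'.symm))]

/-- `U` loads the distribution `p`: it maps `|0⋯0⟩` to `∑ₓ √(p x) |x⟩`. -/
def IsLoader {n : ℕ} (U : Matrix.unitaryGroup (Bits n) ℂ) (p : Bits n → ℝ) : Prop :=
  (U : Matrix (Bits n) (Bits n) ℂ) *ᵥ Pi.single (Bits.zero n) 1 = fun x => ((√(p x) : ℝ) : ℂ)

/-! ### Quantum query algorithms -/

/-- Basis labels of a circuit with an input register of `n` qubits, a fixed-point output register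
and `a` ancilla qubits. -/
abbrev Basis (n c₁ c₂ a : ℕ) : Type := (Bits n × FixedPoint c₁ c₂) × Bits a

instance instDecidableEqBasis (n c₁ c₂ a : ℕ) : DecidableEq (Basis n c₁ c₂ a) :=
  instDecidableEqProd

/-- The operations in a circuit: a fixed unitary on all qubits, a query to `U_NN` (which is its own
inverse), a query to the distribution loader, or a query to the inverse of the loader. -/
inductive Gate (n c₁ c₂ a : ℕ) : Type
  | free (V : Matrix.unitaryGroup (Basis n c₁ c₂ a) ℂ) : Gate n c₁ c₂ a
  | nn : Gate n c₁ c₂ a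
  | load : Gate n c₁ c₂ a
  | loadInv : Gate n c₁ c₂ a

/-- The operator applied by a gate, for given `U_NN = accessUnitary g` and given loader `U`. -/
def Gate.matrix {n c₁ c₂ a : ℕ} (g : Bits n → FixedPoint c₁ c₂)
    (U : Matrix.unitaryGroup (Bits n) ℂ) :
    Gate n c₁ c₂ a → Matrix (Basis n c₁ c₂ a) (Basis n c₁ c₂ a) ℂ
  | .free V => V
  | .nn => accessUnitary g ⊗ₖ (1 : Matrix (Bits a) (Bits a) ℂ)
  | .load => ((U : Matrix (Bits n) (Bits n) ℂ) ⊗ₖ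
      (1 : Matrix (FixedPoint c₁ c₂) (FixedPoint c₁ c₂) ℂ)) ⊗ₖ (1 : Matrix (Bits a) (Bits a) ℂ)
  | .loadInv => ((U : Matrix (Bits n) (Bits n) ℂ)ᴴ ⊗ₖ
      (1 : Matrix (FixedPoint c₁ c₂) (FixedPoint c₁ c₂) ℂ)) ⊗ₖ (1 : Matrix (Bits a) (Bits a) ℂ)

/-- Number of uses of `U_NN` made by a gate. -/
def Gate.nnCost {n c₁ c₂ a : ℕ} : Gate n c₁ c₂ a → ℕ
  | .nn => 1
  | _ => 0

/-- Number of uses of the loader or of its inverse made by a gate. -/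
def Gate.loadCost {n c₁ c₂ a : ℕ} : Gate n c₁ c₂ a → ℕ
  | .load => 1
  | .loadInv => 1
  | _ => 0

/-- A quantum query algorithm: a circuit, started in `|0⋯0⟩` and measured at the end in the
computational basis, with a real number returned for each measurement outcome. The algorithm sees
the two unitaries only through the query gates. -/
structure QueryAlgorithm (n c₁ c₂ : ℕ) : Type where
  ancillas : ℕ
  circuit : List (Gate n c₁ c₂ ancillas)
  output : Basis n c₁ c₂ ancillas → ℝ

/-- Number of queries to `U_NN`. -/
def QueryAlgorithm.nnQueries {n c₁ c₂ : ℕ} (A : QueryAlgorithm n c₁ c₂) : ℕ :=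
  (A.circuit.map Gate.nnCost).sum

/-- Number of queries to the loader and to its inverse. -/
def QueryAlgorithm.loadQueries {n c₁ c₂ : ℕ} (A : QueryAlgorithm n c₁ c₂) : ℕ :=
  (A.circuit.map Gate.loadCost).sum

/-- The state before the measurement. -/
def QueryAlgorithm.finalState {n c₁ c₂ : ℕ} (A : QueryAlgorithm n c₁ c₂)
    (g : Bits n → FixedPoint c₁ c₂) (U : Matrix.unitaryGroup (Bits n) ℂ) :
    Basis n c₁ c₂ A.ancillas → ℂ :=
  A.circuit.foldl (fun ψ G => G.matrix g U *ᵥ ψ)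
    (Pi.single ((Bits.zero n, FixedPoint.zero c₁ c₂), Bits.zero A.ancillas) 1)

/-- The probability that the returned number lies in `S`. -/
def QueryAlgorithm.outputProb {n c₁ c₂ : ℕ} (A : QueryAlgorithm n c₁ c₂)
    (g : Bits n → FixedPoint c₁ c₂) (U : Matrix.unitaryGroup (Bits n) ℂ) (S : Set ℝ) : ℝ :=
  ∑ b, (A.output ⁻¹' S).indicator (fun b => ‖A.finalState g U b‖ ^ 2) b

/-! ### The estimation problem -/

/-- A network with random input: a function `f` on `ℝ^d`; a random vector `X` that takes the value
`point x` with probability `p x`, where `x` runs over the `n`-bit strings; and the word `code x` that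
the circuit of the network computes in fixed-point arithmetic on input `x`. -/
structure Network (n c₁ c₂ : ℕ) : Type where
  d : ℕ
  f : EuclideanSpace ℝ (Fin d) → ℝ
  point : Bits n → EuclideanSpace ℝ (Fin d)
  p : Bits n → ℝ
  p_mem : p ∈ stdSimplex ℝ (Bits n)
  code : Bits n → FixedPoint c₁ c₂

/-- The mean `𝔼 f(X)`. -/
def Network.mean {n c₁ c₂ : ℕ} (N : Network n c₁ c₂) : ℝ := ∑ x, N.p x * N.f (N.point x)

/-- The second moment `𝔼 ‖X‖₂²`. -/
def Network.secondMoment {n c₁ c₂ : ℕ} (N : Network n c₁ c₂) : ℝ :=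
  ∑ x, N.p x * ‖N.point x‖ ^ 2

/-- `L` is a Lipschitz constant of `f`, for distances (`r = 1`) or for squared distances
(`r = 2`). -/
def Network.IsLip {n c₁ c₂ : ℕ} (N : Network n c₁ c₂) (r : ℕ) (L : ℝ) : Prop :=
  ∀ x y, |N.f x - N.f y| ^ r ≤ L * ‖x - y‖ ^ r

/-- On every value that `X` takes, the fixed-point arithmetic computes `f` up to an error `η`. -/
def Network.IsComputedWithin {n c₁ c₂ : ℕ} (N : Network n c₁ c₂) (η : ℝ) : Prop :=
  ∀ x, 0 < N.p x → |(N.code x).value - N.f (N.point x)| ≤ η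

/-- The probability that the average of the outputs on `k` independent classical samples of `X`
lies in `S`. -/
def Network.classicalProb {n c₁ c₂ : ℕ} (N : Network n c₁ c₂) (k : ℕ) (S : Set ℝ) : ℝ :=
  ∑ x : Fin k → Bits n,
    {x : Fin k → Bits n | (∑ i, (N.code (x i)).value) / k ∈ S}.indicator
      (fun x => ∏ i, N.p (x i)) x

end QAMC

end

/-! By the Lipschitz condition `f(X)` deviates from `f 0` by a multiple of `‖X‖`, so the computed
values have mean square deviation at most `2(Λ+ε)²` from `f 0`, for either meaning of `L`
(`Network.sum_sq_sub_le`). Rounding uses up `ε/2`. What remains is to estimate a mean to within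
`ε/2` when a second moment of scale `D = Λ+ε` is known: classically by Chebyshev's inequality with
order `(D/ε)²` samples, quantumly with `Õ(D/ε)` queries.

The quantum engine is amplitude estimation with a mean square error bound. Let `ψ` be the prepared
state, `a` the probability of its flag, `Z` the sign change on flagged vectors and `c = ⟨ψ, Zψ⟩ = 1
- 2a`. The orbit `Zψ, ψ, Gψ, …` of the Grover iteration satisfies `y_k + y_{k+2} = 2c y_{k+1}`. If a
counter with `N` values controls the index and has amplitudes that vanish at both ends, half the
adjacency matrix of a path, acting on the counter, is almost multiplication by `c`. A measurement in
its eigenbasis then estimates `a` with mean square error at most `60a/N² + 15/N⁴`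
(`expect_amplitudeEstimation_le`).

An unbounded variable `v` is cut into its positive and negative parts, and these into dyadic layers
of scale `2^l D`, each rescaled to `[0,1]` and estimated separately. Thanks to the factor `a` above,
the leading errors `4^l D² a_l / N²` add up to `O((D² + E v²)/N²)`, up to the number of layers
(`expect_partEstimate_le`). Truncation at `2^K D` costs a bias of at most `E v²/(2^K D)`. Since `f
0` is unknown, `v` is the deviation from one sampled value, and `E v²` is `O(D²)` on average over
the sample. With `2^K` of order `D/ε` and `N` of order `(K+2)D/ε`, Markov's inequality gives success
probability 0.99 (`le_expect_meanEstimate`).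

Subroutines are composed by deferred measurement (`Procedure.expect_bind`), and the result is
rewritten as a circuit of gates (`exists_queryAlgorithm`). -/

noncomputable section

namespace QAMC

/-! ### Registers, slices and slicewise action -/

/-- The Hilbert space with orthonormal basis indexed by `I`. -/
abbrev Ket (I : Type*) : Type _ := EuclideanSpace ℂ I

section Slice

variable {I A K : Type*}

/-- The part of a vector of `I ≃ A × K` that belongs to the label `k`. -/
def slice (e : I ≃ A × K) (k : K) (Ψ : Ket I) : Ket A :=
  WithLp.toLp 2 fun a => Ψ (e.symm (a, k))

@[simp] theorem slice_apply (e : I ≃ A × K) (k : K) (Ψ : Ket I) (a : A) :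
    slice e k Ψ a = Ψ (e.symm (a, k)) := rfl

theorem slice_ext (e : I ≃ A × K) {Ψ Φ : Ket I} (h : ∀ k, slice e k Ψ = slice e k Φ) : Ψ = Φ := by
  ext i
  have := congrArg (fun v : Ket A => v (e i).1) (h (e i).2)
  simpa using this

variable [Fintype I] [Fintype A] [Fintype K]

theorem norm_sq_eq_sum_slice (e : I ≃ A × K) (Ψ : Ket I) :
    ‖Ψ‖ ^ 2 = ∑ k, ‖slice e k Ψ‖ ^ 2 := by
  simp only [EuclideanSpace.norm_sq_eq, slice_apply]
  rw [← e.symm.sum_comp, Fintype.sum_prod_type_right]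

/-- The family `V k` of isometries applied slice by slice. -/
def actOn (e : I ≃ A × K) (V : K → Ket A ≃ₗᵢ[ℂ] Ket A) : Ket I ≃ₗᵢ[ℂ] Ket I where
  toFun Ψ := WithLp.toLp 2 fun i => V (e i).2 (slice e (e i).2 Ψ) (e i).1
  invFun Ψ := WithLp.toLp 2 fun i => (V (e i).2).symm (slice e (e i).2 Ψ) (e i).1
  map_add' Ψ Φ := by
    ext i
    have : slice e (e i).2 (Ψ + Φ) = slice e (e i).2 Ψ + slice e (e i).2 Φ := by ext; simp
    simp [this]
  map_smul' c Ψ := by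
    ext i
    have : slice e (e i).2 (c • Ψ) = c • slice e (e i).2 Ψ := by ext; simp
    simp [this]
  left_inv Ψ := by
    ext i
    have : slice e (e i).2 (WithLp.toLp 2 fun i => V (e i).2 (slice e (e i).2 Ψ) (e i).1)
        = V (e i).2 (slice e (e i).2 Ψ) := by ext; simp
    simp [this]
  right_inv Ψ := by
    ext i
    have : slice e (e i).2 (WithLp.toLp 2 fun i => (V (e i).2).symm (slice e (e i).2 Ψ) (e i).1)
        = (V (e i).2).symm (slice e (e i).2 Ψ) := by ext; simp
    simp [this]
  norm_map' Ψ := by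
    rw [← sq_eq_sq₀ (norm_nonneg _) (norm_nonneg _), norm_sq_eq_sum_slice e Ψ,
      norm_sq_eq_sum_slice e]
    refine Finset.sum_congr rfl fun k _ => ?_
    rw [← (V k).norm_map (slice e k Ψ)]
    congr 2
    ext a
    simp

theorem actOn_apply (e : I ≃ A × K) (V : K → Ket A ≃ₗᵢ[ℂ] Ket A) (Ψ : Ket I) (i : I) :
    actOn e V Ψ i = V (e i).2 (slice e (e i).2 Ψ) (e i).1 := rfl

theorem slice_actOn (e : I ≃ A × K) (V : K → Ket A ≃ₗᵢ[ℂ] Ket A) (Ψ : Ket I) (k : K) :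
    slice e k (actOn e V Ψ) = V k (slice e k Ψ) := by
  ext a
  simp [actOn_apply]

end Slice

/-! ### Families of circuits -/

/-- An operation on a query register `R` and an ancilla register `W`: a unitary that may depend on
a classical control `C` but not on the queried unitaries, or a query. -/
inductive Step (R Q C W : Type) [Fintype R] [Fintype W] : Type
  | free (V : C → Ket (R × W) ≃ₗᵢ[ℂ] Ket (R × W)) : Step R Q C W
  | query (q : Q) : Step R Q C W

section Circuit

variable {R Q C C' W W' K : Type} [Fintype R] [Fintype W] [Fintype W'] [Fintype K]

/-- The operator applied by a step when the queried unitaries are `O`. -/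
def Step.op (O : Q → Ket R ≃ₗᵢ[ℂ] Ket R) (c : C) : Step R Q C W → Ket (R × W) ≃ₗᵢ[ℂ] Ket (R × W)
  | .free V => V c
  | .query q => actOn (Equiv.refl _) fun _ => O q

/-- Number of queries of a step. -/
def Step.cost : Step R Q C W → ℕ
  | .free _ => 0
  | .query _ => 1

/-- Number of queries of a circuit. -/
def cost (l : List (Step R Q C W)) : ℕ := (l.map Step.cost).sum

/-- The operator applied by a circuit. -/
def run (O : Q → Ket R ≃ₗᵢ[ℂ] Ket R) (c : C) : List (Step R Q C W) →
    Ket (R × W) ≃ₗᵢ[ℂ] Ket (R × W)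
  | [] => LinearIsometryEquiv.refl ℂ _
  | s :: l => (s.op O c).trans (run O c l)

theorem run_nil (O : Q → Ket R ≃ₗᵢ[ℂ] Ket R) (c : C) (Ψ : Ket (R × W)) :
    run O c ([] : List (Step R Q C W)) Ψ = Ψ := rfl

theorem run_cons (O : Q → Ket R ≃ₗᵢ[ℂ] Ket R) (c : C) (s : Step R Q C W)
    (l : List (Step R Q C W)) (Ψ : Ket (R × W)) : run O c (s :: l) Ψ = run O c l (s.op O c Ψ) := rfl

theorem run_append (O : Q → Ket R ≃ₗᵢ[ℂ] Ket R) (c : C) (l₁ l₂ : List (Step R Q C W))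
    (Ψ : Ket (R × W)) : run O c (l₁ ++ l₂) Ψ = run O c l₂ (run O c l₁ Ψ) := by
  induction l₁ generalizing Ψ with
  | nil => rfl
  | cons s l ih => simp [run_cons, ih]

/-- Regrouping of `R × W'` for an ancilla register `W'` made of a spectator `K` and of `W`. -/
def spectatorEquiv (R : Type) (e : W' ≃ K × W) : R × W' ≃ (R × W) × K where
  toFun b := ((b.1, (e b.2).2), (e b.2).1)
  invFun b := (b.1.1, e.symm (b.2, b.1.2))
  left_inv b := by simp
  right_inv b := by simp

/-- The step on a larger ancilla register in which the spectator `K` acts as a further control. -/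
def Step.lift (e : W' ≃ K × W) (f : C → K → C') : Step R Q C' W → Step R Q C W'
  | .free V => .free fun c => actOn (spectatorEquiv R e) fun k => V (f c k)
  | .query q => .query q

theorem slice_op_lift (O : Q → Ket R ≃ₗᵢ[ℂ] Ket R) (e : W' ≃ K × W) (f : C → K → C')
    (s : Step R Q C' W) (c : C) (k : K) (Ψ : Ket (R × W')) :
    slice (spectatorEquiv R e) k ((s.lift e f).op O c Ψ) =
      s.op O (f c k) (slice (spectatorEquiv R e) k Ψ) := by
  cases s with
  | free V => exact slice_actOn _ _ _ _
  | query q => rfl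

/-- Free steps act slice by slice, and queries do not touch the ancillas, so slices never mix. Whole
subroutines can thus be controlled although queries are never controlled. -/
theorem slice_run_lift (O : Q → Ket R ≃ₗᵢ[ℂ] Ket R) (e : W' ≃ K × W) (f : C → K → C')
    (l : List (Step R Q C' W)) (c : C) (k : K) (Ψ : Ket (R × W')) :
    slice (spectatorEquiv R e) k (run O c (l.map (Step.lift e f)) Ψ) =
      run O (f c k) l (slice (spectatorEquiv R e) k Ψ) := by
  induction l generalizing Ψ with
  | nil => rfl
  | cons s l ih => rw [List.map_cons, run_cons, run_cons, ih, slice_op_lift]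

theorem cost_map_lift (e : W' ≃ K × W) (f : C → K → C') (l : List (Step R Q C' W)) :
    cost (l.map (Step.lift e f)) = cost l := by
  unfold cost
  rw [List.map_map]
  congr 2
  funext s
  cases s <;> rfl

theorem cost_free_cons (V : C → Ket (R × W) ≃ₗᵢ[ℂ] Ket (R × W)) (l : List (Step R Q C W)) :
    cost (.free V :: l) = cost l := by
  simp [cost, Step.cost]

theorem cost_query_cons (q : Q) (l : List (Step R Q C W)) :
    cost (.query q :: l) = cost l + 1 := by
  simp [cost, Step.cost, add_comm]

theorem cost_append (l₁ l₂ : List (Step R Q C W)) : cost (l₁ ++ l₂) = cost l₁ + cost l₂ := by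
  simp [cost]

end Circuit

/-! ### Procedures -/

/-- A family of query algorithms with query register `R`, queries `Q`, classical control `C` and
outcomes in `Ω`. -/
structure Procedure (R Q C Ω : Type) [Fintype R] : Type 1 where
  W : Type
  [fintype : Fintype W]
  [decEq : DecidableEq W]
  init : W
  size : ℕ
  card_eq : Fintype.card W = 2 ^ size
  steps : List (Step R Q C W)
  out : R × W → Ω

attribute [instance] Procedure.fintype Procedure.decEq

namespace Procedure

variable {R Q C C' Ω Ω₁ Ω₂ : Type} [Fintype R] [DecidableEq R]

/-- The state before the measurement. -/
def final (P : Procedure R Q C Ω) (O : Q → Ket R ≃ₗᵢ[ℂ] Ket R) (r₀ : R) (c : C) : Ket (R × P.W) :=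
  run O c P.steps (EuclideanSpace.single (r₀, P.init) 1)

/-- The expectation of a function of the outcome. -/
def expect (P : Procedure R Q C Ω) (O : Q → Ket R ≃ₗᵢ[ℂ] Ket R) (r₀ : R) (c : C) (F : Ω → ℝ) : ℝ :=
  ∑ b, ‖P.final O r₀ c b‖ ^ 2 * F (P.out b)

variable (O : Q → Ket R ≃ₗᵢ[ℂ] Ket R) (r₀ : R) (c : C)

theorem norm_final (P : Procedure R Q C Ω) : ‖P.final O r₀ c‖ = 1 := by
  simp [final]

theorem expect_const (P : Procedure R Q C Ω) (x : ℝ) : P.expect O r₀ c (fun _ => x) = x := by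
  unfold expect
  rw [← Finset.sum_mul, ← EuclideanSpace.norm_sq_eq, norm_final]
  simp

theorem expect_mono (P : Procedure R Q C Ω) {F G : Ω → ℝ} (h : ∀ ω, F ω ≤ G ω) :
    P.expect O r₀ c F ≤ P.expect O r₀ c G :=
  Finset.sum_le_sum fun b _ => mul_le_mul_of_nonneg_left (h _) (by positivity)

theorem expect_add (P : Procedure R Q C Ω) (F G : Ω → ℝ) :
    P.expect O r₀ c (fun ω => F ω + G ω) = P.expect O r₀ c F + P.expect O r₀ c G := by
  simp [expect, mul_add, Finset.sum_add_distrib]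

theorem expect_const_mul (P : Procedure R Q C Ω) (x : ℝ) (F : Ω → ℝ) :
    P.expect O r₀ c (fun ω => x * F ω) = x * P.expect O r₀ c F := by
  simp only [expect, Finset.mul_sum]
  exact Finset.sum_congr rfl fun b _ => by ring

/-- Run `P₁`, keep its registers, and run `P₂` with a control computed from the outcome of `P₁`. -/
def bind (P₁ : Procedure R Q C Ω₁) (P₂ : Procedure R Q C' Ω₂) (r₀ : R) (f : C → Ω₁ → C')
    (h : Ω₁ → Ω₂ → Ω) (size : ℕ) (hsize : Fintype.card R = 2 ^ size) : Procedure R Q C Ω where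
  W := R × P₁.W × P₂.W
  init := (r₀, P₁.init, P₂.init)
  size := size + (P₁.size + P₂.size)
  card_eq := by simp [pow_add, P₁.card_eq, P₂.card_eq, hsize]
  steps := P₁.steps.map (Step.lift
      (⟨fun w => ((w.1, w.2.2), w.2.1), fun w => (w.1.1, w.2, w.1.2), fun _ => rfl, fun _ => rfl⟩ :
        R × P₁.W × P₂.W ≃ (R × P₂.W) × P₁.W) fun c _ => c) ++
    -- The swap stores away the query register used by `P₁` and hands `P₂` a copy that is still in
    -- the state `r₀`.
    .free (fun _ => LinearIsometryEquiv.piLpCongrLeft 2 ℂ ℂ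
      (⟨fun b => (b.2.1, b.1, b.2.2), fun b => (b.2.1, b.1, b.2.2), fun _ => rfl, fun _ => rfl⟩ :
        R × R × P₁.W × P₂.W ≃ R × R × P₁.W × P₂.W)) ::
    P₂.steps.map (Step.lift
      (⟨fun w => ((w.1, w.2.1), w.2.2), fun w => (w.1.1, w.1.2, w.2), fun _ => rfl, fun _ => rfl⟩ :
        R × P₁.W × P₂.W ≃ (R × P₁.W) × P₂.W) fun c k => f c (P₁.out k))
  out b := h (P₁.out (b.2.1, b.2.2.1)) (P₂.out (b.1, b.2.2.2))

theorem cost_bind (P₁ : Procedure R Q C Ω₁) (P₂ : Procedure R Q C' Ω₂) (f : C → Ω₁ → C')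
    (h : Ω₁ → Ω₂ → Ω) (size : ℕ) (hsize : Fintype.card R = 2 ^ size) :
    cost (P₁.bind P₂ r₀ f h size hsize).steps = cost P₁.steps + cost P₂.steps := by
  unfold bind
  rw [cost_append, cost_free_cons, cost_map_lift, cost_map_lift]

/-- Deferred measurement: after the swap the registers of `P₁` serve only as a control, so each of
their basis states selects its own run of `P₂` and amplitudes multiply. -/
theorem final_bind (P₁ : Procedure R Q C Ω₁) (P₂ : Procedure R Q C' Ω₂) (f : C → Ω₁ → C')
    (h : Ω₁ → Ω₂ → Ω) (size : ℕ) (hsize : Fintype.card R = 2 ^ size)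
    (r s : R) (w₁ : P₁.W) (w₂ : P₂.W) :
    (P₁.bind P₂ r₀ f h size hsize).final O r₀ c (r, s, w₁, w₂) =
      P₁.final O r₀ c (s, w₁) * P₂.final O r₀ (f c (P₁.out (s, w₁))) (r, w₂) := by
  let e₁ : R × P₁.W × P₂.W ≃ (R × P₂.W) × P₁.W :=
    ⟨fun w => ((w.1, w.2.2), w.2.1), fun w => (w.1.1, w.2, w.1.2), fun _ => rfl, fun _ => rfl⟩
  let e₂ : R × P₁.W × P₂.W ≃ (R × P₁.W) × P₂.W :=
    ⟨fun w => ((w.1, w.2.1), w.2.2), fun w => (w.1.1, w.1.2, w.2), fun _ => rfl, fun _ => rfl⟩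
  set Ψ₀ : Ket (R × R × P₁.W × P₂.W) := EuclideanSpace.single (r₀, r₀, P₁.init, P₂.init) 1 with hΨ₀
  set Ψ₁ := run O c (P₁.steps.map (Step.lift e₁ fun c _ => c)) Ψ₀ with hΨ₁
  have h₁ : ∀ k, slice (spectatorEquiv R e₁) k Ψ₁ =
      (if k = (r₀, P₂.init) then (1 : ℂ) else 0) • P₁.final O r₀ c := by
    intro k
    rw [hΨ₁, slice_run_lift, final, ← map_smul]
    congr 1
    ext ⟨r, w⟩
    simp only [hΨ₀, slice_apply, spectatorEquiv, e₁, Equiv.coe_fn_symm_mk, PiLp.smul_apply,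
      PiLp.single_apply, Prod.ext_iff, smul_eq_mul]
    split_ifs <;> simp_all
  set Ψ₂ : Ket (R × R × P₁.W × P₂.W) := LinearIsometryEquiv.piLpCongrLeft 2 ℂ ℂ
      (⟨fun b => (b.2.1, b.1, b.2.2), fun b => (b.2.1, b.1, b.2.2), fun _ => rfl, fun _ => rfl⟩ :
        R × R × P₁.W × P₂.W ≃ R × R × P₁.W × P₂.W) Ψ₁ with hΨ₂
  have h₂ : ∀ k, slice (spectatorEquiv R e₂) k Ψ₂ =
      P₁.final O r₀ c k • EuclideanSpace.single (r₀, P₂.init) 1 := by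
    rintro ⟨s, w₁⟩
    ext ⟨r, w₂⟩
    have := congrArg (fun v : Ket (R × P₁.W) => v (s, w₁)) (h₁ (r, w₂))
    simp only [slice_apply, spectatorEquiv, e₁, Equiv.coe_fn_symm_mk, PiLp.smul_apply,
      smul_eq_mul] at this
    simp only [hΨ₂, slice_apply, spectatorEquiv, e₂, Equiv.coe_fn_symm_mk, PiLp.smul_apply,
      PiLp.single_apply, smul_eq_mul, LinearIsometryEquiv.piLpCongrLeft_apply,
      Equiv.piCongrLeft'_apply]
    rw [this, mul_comm]
  have h₃ : (P₁.bind P₂ r₀ f h size hsize).final O r₀ c =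
      run O c (P₂.steps.map (Step.lift e₂ fun c k => f c (P₁.out k))) Ψ₂ := by
    unfold final bind
    rw [run_append, run_cons]
    rfl
  have h₄ := slice_run_lift O e₂ (fun c k => f c (P₁.out k)) P₂.steps c (s, w₁) Ψ₂
  rw [h₂, map_smul, ← h₃] at h₄
  exact congrArg (fun v : Ket (R × P₂.W) => v (r, w₂)) h₄

theorem expect_bind (P₁ : Procedure R Q C Ω₁) (P₂ : Procedure R Q C' Ω₂) (f : C → Ω₁ → C')
    (h : Ω₁ → Ω₂ → Ω) (size : ℕ) (hsize : Fintype.card R = 2 ^ size) (F : Ω → ℝ) :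
    (P₁.bind P₂ r₀ f h size hsize).expect O r₀ c F =
      P₁.expect O r₀ c fun ω => P₂.expect O r₀ (f c ω) fun ω' => F (h ω ω') := by
  have : (P₁.bind P₂ r₀ f h size hsize).expect O r₀ c F = ∑ b : R × R × P₁.W × P₂.W,
      ‖P₁.final O r₀ c (b.2.1, b.2.2.1) *
        P₂.final O r₀ (f c (P₁.out (b.2.1, b.2.2.1))) (b.1, b.2.2.2)‖ ^ 2 *
      F (h (P₁.out (b.2.1, b.2.2.1)) (P₂.out (b.1, b.2.2.2))) := by
    refine Finset.sum_congr rfl ?_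
    rintro ⟨r, s, w₁, w₂⟩ -
    rw [final_bind]
    rfl
  rw [this]
  simp only [expect, Fintype.sum_prod_type, Finset.mul_sum]
  rw [Finset.sum_comm]
  refine Finset.sum_congr rfl fun s _ => ?_
  rw [Finset.sum_comm]
  refine Finset.sum_congr rfl fun w₁ _ => Finset.sum_congr rfl fun r _ =>
    Finset.sum_congr rfl fun w₂ _ => ?_
  rw [norm_mul, mul_pow]
  ring

end Procedure

/-! ### Amplitude estimation -/

/-- The recurrence turns the vector into half of `(p - r)(x₂ - x₀) + (p + q - 2r)x₀`, a first and a
second difference of the weights. The parallelogram law gives `‖x₂ - x₀‖² = 4 - 4c²`, which is small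
when `c` is near `±1`. -/
theorem norm_sq_three_term_le {E : Type*} [NormedAddCommGroup E] [InnerProductSpace ℝ E]
    {x₀ x₁ x₂ : E} {c : ℝ} (h : x₀ + x₂ = (2 * c) • x₁) (h₀ : ‖x₀‖ = 1) (h₁ : ‖x₁‖ = 1)
    (h₂ : ‖x₂‖ = 1) (p q r : ℝ) :
    ‖(1 / 2 : ℝ) • (q • x₀ + p • x₂) - (c * r) • x₁‖ ^ 2 ≤
      2 * (1 - c ^ 2) * (p - r) ^ 2 + (p + q - 2 * r) ^ 2 / 2 := by
  have e : (1 / 2 : ℝ) • (q • x₀ + p • x₂) - (c * r) • x₁ =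
      (1 / 2 : ℝ) • ((p - r) • (x₂ - x₀) + (p + q - 2 * r) • x₀) := by
    have : (c * r) • x₁ = (r / 2) • (x₀ + x₂) := by
      rw [h, smul_smul]
      congr 1
      ring
    rw [this]
    module
  have hp := parallelogram_law_with_norm ℝ x₂ x₀
  rw [add_comm x₂ x₀, h, norm_smul, h₀, h₁, h₂, Real.norm_eq_abs, mul_one, sq_abs] at hp
  have hq := parallelogram_law_with_norm ℝ ((p - r) • (x₂ - x₀)) ((p + q - 2 * r) • x₀)
  rw [norm_smul, norm_smul, h₀, Real.norm_eq_abs, Real.norm_eq_abs, mul_one] at hq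
  rw [mul_pow, sq_abs, sq_abs, show ‖x₂ - x₀‖ ^ 2 = 4 - 4 * c ^ 2 by linear_combination hp] at hq
  rw [e, norm_smul, mul_pow]
  norm_num
  nlinarith [sq_nonneg ‖(p - r) • (x₂ - x₀) - (p + q - 2 * r) • x₀‖]

/-! ### Path matrix and window -/

/-- Half the adjacency matrix of the path on `N` vertices. -/
def pathMatrix (N : ℕ) : Matrix (Fin N) (Fin N) ℂ :=
  Matrix.of fun k l => if (l : ℕ) = k + 1 ∨ (k : ℕ) = l + 1 then 1 / 2 else 0

theorem pathMatrix_isHermitian (N : ℕ) : (pathMatrix N).IsHermitian := by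
  ext k l
  simp only [Matrix.conjTranspose_apply, pathMatrix, Matrix.of_apply, or_comm (a := (k : ℕ) = l + 1)]
  split_ifs <;> simp

/-- The zeros of `f` at `0` and `N + 1` supply the missing neighbours of the two end vertices, so
the formula has no boundary cases. -/
theorem pathMatrix_mulVec {N : ℕ} (f : ℕ → ℂ) (h0 : f 0 = 0) (hN : f (N + 1) = 0) (k : Fin N) :
    (pathMatrix N *ᵥ fun l => f (l + 1)) k = 1 / 2 * (f k + f (k + 2)) := by
  have e : ∀ l : ℕ, (if l = (k : ℕ) + 1 ∨ (k : ℕ) = l + 1 then (1 / 2 : ℂ) else 0) * f (l + 1) =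
      (if l = (k : ℕ) + 1 then 1 / 2 * f (l + 1) else 0) +
        if (k : ℕ) = l + 1 then 1 / 2 * f (l + 1) else 0 := by
    intro l
    by_cases h1 : l = (k : ℕ) + 1
    · have h2 : ¬ (k : ℕ) = l + 1 := by omega
      simp only [h1, true_or, if_true]
      rw [if_neg (by omega), add_zero]
    · simp [h1]
  have h1 : (pathMatrix N *ᵥ fun l => f (l + 1)) k = ∑ l ∈ Finset.range N,
      (if l = (k : ℕ) + 1 ∨ (k : ℕ) = l + 1 then (1 / 2 : ℂ) else 0) * f (l + 1) := by
    rw [← Fin.sum_univ_eq_sum_range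
      (fun l => (if l = (k : ℕ) + 1 ∨ (k : ℕ) = l + 1 then (1 / 2 : ℂ) else 0) * f (l + 1))]
    rfl
  rw [h1, Finset.sum_congr rfl fun l _ => e l, Finset.sum_add_distrib, Finset.sum_ite_eq', add_comm,
    mul_add]
  congr 1
  · obtain ⟨k, hk⟩ := k
    cases k with
    | zero => simp [h0]
    | succ k =>
      simp only [Nat.add_right_cancel_iff]
      rw [Finset.sum_ite_eq, if_pos (Finset.mem_range.2 (by omega))]
  · split_ifs with h
    · rfl
    · have : (k : ℕ) + 2 = N + 1 := by
        have := k.2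
        rw [Finset.mem_range] at h
        omega
      simp [this, hN]

/-- The quadratic window `j (N + 1 - j)`, which vanishes at `0` and at `N + 1`. -/
def window (N j : ℕ) : ℝ := j * (N + 1 - j)

theorem pow_five_le_sum_window_sq (N : ℕ) :
    (N : ℝ) ^ 5 ≤ 30 * ∑ k : Fin N, window N (k + 1) ^ 2 := by
  -- The parameter `x` stands for `N + 1`, which must stay fixed while the induction runs over the
  -- number of summands.
  have key : ∀ (x : ℝ) (n : ℕ), 30 * ∑ k ∈ Finset.range n, (((k : ℝ) + 1) * (x - (k + 1))) ^ 2 =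
      x ^ 2 * (5 * n * (n + 1) * (2 * n + 1)) - 15 * x * (n ^ 2 * (n + 1) ^ 2) +
        n * (n + 1) * (2 * n + 1) * (3 * n ^ 2 + 3 * n - 1) := by
    intro x n
    induction n with
    | zero => simp
    | succ n ih =>
      rw [Finset.sum_range_succ, mul_add, ih]
      push_cast
      ring
  have := key (N + 1) N
  unfold window
  rw [Fin.sum_univ_eq_sum_range (fun k => (((k + 1 : ℕ) : ℝ) * ((N : ℝ) + 1 - (k + 1 : ℕ))) ^ 2)]
  push_cast
  rw [this]
  have : ((N : ℝ) + 1) ^ 2 * (5 * N * (N + 1) * (2 * N + 1)) - 15 * (N + 1) * (N ^ 2 * (N + 1) ^ 2) +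
        N * (N + 1) * (2 * N + 1) * (3 * N ^ 2 + 3 * N - 1) =
      N ^ 5 + 5 * N ^ 4 + 10 * N ^ 3 + 10 * N ^ 2 + 4 * N := by ring
  rw [this]
  have : (0 : ℝ) ≤ 5 * N ^ 4 + 10 * N ^ 3 + 10 * N ^ 2 + 4 * N := by positivity
  linarith

theorem sum_window_diff_sq_le (N : ℕ) :
    ∑ k : Fin N, (window N (k + 2) - window N (k + 1)) ^ 2 ≤ (N : ℝ) ^ 3 := by
  -- The difference is `N - 2(k + 1)`, which lies in `[-N, N]`.
  have : ∀ k : Fin N, (window N (k + 2) - window N (k + 1)) ^ 2 ≤ (N : ℝ) ^ 2 := by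
    intro k
    have hk : ((k : ℕ) : ℝ) + 1 ≤ N := by exact_mod_cast k.2
    have h0 : (0 : ℝ) ≤ ((k : ℕ) : ℝ) := Nat.cast_nonneg _
    apply sq_le_sq'
    · unfold window; push_cast; nlinarith
    · unfold window; push_cast; nlinarith
  calc _ ≤ ∑ _k : Fin N, (N : ℝ) ^ 2 := Finset.sum_le_sum fun k _ => this k
    _ = (N : ℝ) ^ 3 := by simp; ring

theorem sum_window_second_diff_sq (N : ℕ) :
    ∑ k : Fin N, (window N (k + 2) + window N k - 2 * window N (k + 1)) ^ 2 = 4 * (N : ℝ) := by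
  have : ∀ k : Fin N, (window N (k + 2) + window N k - 2 * window N (k + 1)) ^ 2 = 4 := by
    intro k
    unfold window
    push_cast
    ring
  simp [this, mul_comm]

/-! ### State preparation and the Grover iteration -/

theorem exists_isometry_single {I : Type*} [Fintype I] [DecidableEq I] (i : I) {u : Ket I}
    (hu : ‖u‖ = 1) : ∃ V : Ket I ≃ₗᵢ[ℂ] Ket I, V (EuclideanSpace.single i 1) = u := by
  obtain ⟨b, hb⟩ := Orthonormal.exists_orthonormalBasis_extension_of_card_eq (𝕜 := ℂ)
    (E := Ket I) (ι := I) (by simp) (v := fun _ => u) (s := {i})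
    ⟨fun _ => by simp [hu], fun a b hab => absurd (Subsingleton.elim a b) hab⟩
  refine ⟨b.repr.symm, ?_⟩
  rw [b.repr_symm_single, hb i rfl]

/-- Some isometry that maps a basis vector to the unit vector `u`. -/
def prepare {I : Type*} [Fintype I] [DecidableEq I] (i : I) (u : Ket I) : Ket I ≃ₗᵢ[ℂ] Ket I :=
  if hu : ‖u‖ = 1 then (exists_isometry_single i hu).choose else LinearIsometryEquiv.refl ℂ _

theorem prepare_single {I : Type*} [Fintype I] [DecidableEq I] (i : I) {u : Ket I}
    (hu : ‖u‖ = 1) : prepare i u (EuclideanSpace.single i 1) = u := by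
  unfold prepare
  rw [dif_pos hu]
  exact (exists_isometry_single i hu).choose_spec

/-- The diagonal isometry that changes the sign of the basis vectors in `s`. -/
def signFlip {I : Type*} [Fintype I] (s : I → Prop) [DecidablePred s] : Ket I ≃ₗᵢ[ℂ] Ket I :=
  LinearIsometryEquiv.piLpCongrRight 2 fun i =>
    if s i then LinearIsometryEquiv.neg ℂ else LinearIsometryEquiv.refl ℂ ℂ

theorem signFlip_apply {I : Type*} [Fintype I] (s : I → Prop) [DecidablePred s] (Ψ : Ket I) (i : I) :
    signFlip s Ψ i = if s i then -Ψ i else Ψ i := by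
  unfold signFlip
  rw [LinearIsometryEquiv.piLpCongrRight_apply]
  simp only
  split_ifs <;> simp

theorem signFlip_signFlip {I : Type*} [Fintype I] (s : I → Prop) [DecidablePred s] (Ψ : Ket I) :
    signFlip s (signFlip s Ψ) = Ψ := by
  ext i
  simp only [signFlip_apply]
  split_ifs <;> simp

/-- The reflection-based iteration `A (2|i⟩⟨i| - 1) A⁻¹ Z`. -/
def groverIter {I : Type*} [Fintype I] [DecidableEq I] (A Z : Ket I ≃ₗᵢ[ℂ] Ket I) (i : I) :
    Ket I ≃ₗᵢ[ℂ] Ket I :=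
  Z.trans (A.symm.trans ((signFlip fun j => j ≠ i).trans A))

theorem groverIter_apply {I : Type*} [Fintype I] [DecidableEq I] (A Z : Ket I ≃ₗᵢ[ℂ] Ket I) (i : I)
    (Ψ : Ket I) : groverIter A Z i Ψ =
      (2 * A.symm (Z Ψ) i) • A (EuclideanSpace.single i 1) - Z Ψ := by
  have : ∀ v : Ket I, signFlip (fun j => j ≠ i) v = (2 * v i) • EuclideanSpace.single i 1 - v := by
    intro v
    ext j
    rw [signFlip_apply]
    by_cases h : j = i
    · subst h; simp; ring
    · simp [h]
  change A (signFlip _ (A.symm (Z Ψ))) = _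
  rw [this, map_sub, map_smul, A.apply_symm_apply]

/-- Since `Z² = 1` and the reflection fixes `ψ`, the orbit can start one step earlier, at `Zψ`. This
vector has index `0` in the recurrence. -/
theorem groverIter_involution {I : Type*} [Fintype I] [DecidableEq I] (A Z : Ket I ≃ₗᵢ[ℂ] Ket I)
    (i : I) (hZ : ∀ v, Z (Z v) = v) :
    groverIter A Z i (Z (A (EuclideanSpace.single i 1))) = A (EuclideanSpace.single i 1) := by
  rw [groverIter_apply, hZ, A.symm_apply_apply]
  simp [two_smul]

theorem groverIter_three_term {I : Type*} [Fintype I] [DecidableEq I] (A Z : Ket I ≃ₗᵢ[ℂ] Ket I)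
    (i : I) (c : ℝ) (hc : inner ℂ (A (EuclideanSpace.single i 1))
      (Z (A (EuclideanSpace.single i 1))) = (c : ℂ)) :
    Z (A (EuclideanSpace.single i 1)) + groverIter A Z i (A (EuclideanSpace.single i 1)) =
      (2 * c) • A (EuclideanSpace.single i 1) := by
  have : A.symm (Z (A (EuclideanSpace.single i 1))) i = c := by
    rw [← hc, ← A.symm.inner_map_map, A.symm_apply_apply, EuclideanSpace.inner_single_left]
    simp
  rw [groverIter_apply, this, add_sub_cancel]
  ext j
  simp

/-- The orbit `Z ψ, ψ, G ψ, G² ψ, …` of `ψ = A|i⟩` under the iteration `G`. -/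
def groverOrbit {I : Type*} [Fintype I] [DecidableEq I] (A Z : Ket I ≃ₗᵢ[ℂ] Ket I) (i : I) (k : ℕ) :
    Ket I := (groverIter A Z i)^[k] (Z (A (EuclideanSpace.single i 1)))

theorem groverOrbit_succ {I : Type*} [Fintype I] [DecidableEq I] (A Z : Ket I ≃ₗᵢ[ℂ] Ket I)
    (i : I) (hZ : ∀ v, Z (Z v) = v) (k : ℕ) :
    groverOrbit A Z i (k + 1) = (groverIter A Z i)^[k] (A (EuclideanSpace.single i 1)) := by
  rw [groverOrbit, Function.iterate_succ_apply, groverIter_involution A Z i hZ]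

theorem norm_groverOrbit {I : Type*} [Fintype I] [DecidableEq I] (A Z : Ket I ≃ₗᵢ[ℂ] Ket I)
    (i : I) (k : ℕ) : ‖groverOrbit A Z i k‖ = 1 := by
  induction k with
  | zero => simp [groverOrbit]
  | succ k ih =>
    rw [groverOrbit, Function.iterate_succ_apply', LinearIsometryEquiv.norm_map]
    exact ih

/-- At `k = 0` this is the formula `Gψ = 2⟨ψ, Zψ⟩ψ - Zψ` for the reflection about `ψ`; applying the
linear map `G` repeatedly shifts the index. -/
theorem groverOrbit_three_term {I : Type*} [Fintype I] [DecidableEq I] (A Z : Ket I ≃ₗᵢ[ℂ] Ket I)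
    (i : I) (hZ : ∀ v, Z (Z v) = v) (c : ℝ) (hc : inner ℂ (A (EuclideanSpace.single i 1))
      (Z (A (EuclideanSpace.single i 1))) = (c : ℂ)) (k : ℕ) :
    groverOrbit A Z i k + groverOrbit A Z i (k + 2) = (2 * c) • groverOrbit A Z i (k + 1) := by
  induction k with
  | zero =>
    rw [groverOrbit_succ A Z i hZ, groverOrbit_succ A Z i hZ]
    exact groverIter_three_term A Z i c hc
  | succ k ih =>
    have s : ∀ m, groverOrbit A Z i (m + 1) = groverIter A Z i (groverOrbit A Z i m) := fun m => by
      rw [groverOrbit, Function.iterate_succ_apply']; rfl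
    have e : groverOrbit A Z i (k + 1) + groverOrbit A Z i (k + 1 + 2) =
        groverIter A Z i (groverOrbit A Z i k + groverOrbit A Z i (k + 2)) := by
      rw [map_add, ← s k, ← s (k + 2)]
    rw [e, ih, s (k + 1)]
    ext j
    rw [← Complex.coe_smul, ← Complex.coe_smul, map_smul]

/-- For a counter in the state `w k ∝ window N (k + 1)` that controls the number of iterations,
the path matrix nearly acts as multiplication by `c`. -/
theorem sum_norm_sq_window_orbit_le {I : Type*} [Fintype I] [DecidableEq I]
    (A Z : Ket I ≃ₗᵢ[ℂ] Ket I)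
    (i : I) (hZ : ∀ v, Z (Z v) = v) (c : ℝ) (hc : inner ℂ (A (EuclideanSpace.single i 1))
      (Z (A (EuclideanSpace.single i 1))) = (c : ℂ)) (hc1 : c ^ 2 ≤ 1) (N : ℕ) :
    ∑ k : Fin N, ‖(1 / 2 : ℝ) • (window N k • groverOrbit A Z i k +
      window N (k + 2) • groverOrbit A Z i (k + 2)) -
        (c * window N (k + 1)) • groverOrbit A Z i (k + 1)‖ ^ 2 ≤
      2 * (1 - c ^ 2) * N ^ 3 + 2 * N := by
  calc _ ≤ ∑ k : Fin N, (2 * (1 - c ^ 2) * (window N (k + 2) - window N (k + 1)) ^ 2 +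
        (window N (k + 2) + window N k - 2 * window N (k + 1)) ^ 2 / 2) :=
        Finset.sum_le_sum fun k _ => norm_sq_three_term_le
          (groverOrbit_three_term A Z i hZ c hc k) (norm_groverOrbit ..) (norm_groverOrbit ..)
          (norm_groverOrbit ..) _ _ _
    _ ≤ _ := by
        rw [Finset.sum_add_distrib, ← Finset.mul_sum, ← Finset.sum_div, sum_window_second_diff_sq]
        have := mul_le_mul_of_nonneg_left (sum_window_diff_sq_le N)
          (show 0 ≤ 2 * (1 - c ^ 2) by linarith)
        linarith

/-- Parseval for `(T - c)χ` in the eigenbasis: if `χ` almost satisfies `Tχ = cχ`, the measured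
eigenvalue is close to `c` in mean square. -/
theorem sum_norm_sq_eigenvectorBasis_repr {ι : Type*} [Fintype ι] [DecidableEq ι]
    {T : Matrix ι ι ℂ} (hT : T.IsHermitian) (χ : Ket ι) (c : ℝ) :
    ∑ y, ‖hT.eigenvectorBasis.repr χ y‖ ^ 2 * (hT.eigenvalues y - c) ^ 2 =
      ∑ k, ‖(T *ᵥ χ) k - c * χ k‖ ^ 2 := by
  have h1 : ∑ k, ‖(T *ᵥ χ) k - c * χ k‖ ^ 2 = ‖Matrix.toEuclideanLin T χ - (c : ℂ) • χ‖ ^ 2 := by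
    rw [EuclideanSpace.norm_sq_eq]
    rfl
  rw [h1, ← hT.eigenvectorBasis.repr.norm_map, EuclideanSpace.norm_sq_eq]
  refine Finset.sum_congr rfl fun y _ => ?_
  have h2 : Matrix.toEuclideanLin T (hT.eigenvectorBasis y) =
      ((hT.eigenvalues y : ℝ) : ℂ) • hT.eigenvectorBasis y := by
    ext j
    have := congrFun (hT.mulVec_eigenvectorBasis y) j
    simpa using this
  have h3 : hT.eigenvectorBasis.repr (Matrix.toEuclideanLin T χ) y =
      hT.eigenvalues y * hT.eigenvectorBasis.repr χ y := by
    rw [OrthonormalBasis.repr_apply_apply, OrthonormalBasis.repr_apply_apply,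
      ← Matrix.isSymmetric_toEuclideanLin_iff.mpr hT, h2, inner_smul_left, Complex.conj_ofReal]
  rw [map_sub, map_smul, PiLp.sub_apply, PiLp.smul_apply, h3, smul_eq_mul, ← sub_mul, norm_mul,
    mul_pow, mul_comm, ← Complex.ofReal_sub, Complex.norm_real, Real.norm_eq_abs, sq_abs]

/-! ### The amplitude estimation circuit -/

section AmplitudeEstimation

variable {R Q C : Type} [Fintype R]

/-- The operator of a sequence of queries. -/
def queryOp (O : Q → Ket R ≃ₗᵢ[ℂ] Ket R) (l : List Q) (v : Ket R) : Ket R :=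
  l.foldl (fun v q => O q v) v

theorem slice_run_query {W : Type} [Fintype W] (O : Q → Ket R ≃ₗᵢ[ℂ] Ket R) (c : C) (l : List Q)
    (Ψ : Ket (R × W)) (w : W) :
    slice (Equiv.refl (R × W)) w (run O c (l.map Step.query) Ψ) =
      queryOp O l (slice (Equiv.refl (R × W)) w Ψ) := by
  induction l generalizing Ψ with
  | nil => rfl
  | cons q l ih => rw [List.map_cons, run_cons, ih]; rfl

theorem queryOp_zero (O : Q → Ket R ≃ₗᵢ[ℂ] Ket R) (l : List Q) : queryOp O l 0 = 0 := by
  induction l with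
  | nil => rfl
  | cons q l ih => rw [queryOp, List.foldl_cons, map_zero]; exact ih

theorem norm_queryOp (O : Q → Ket R ≃ₗᵢ[ℂ] Ket R) (l : List Q) (v : Ket R) :
    ‖queryOp O l v‖ = ‖v‖ := by
  induction l generalizing v with
  | nil => rfl
  | cons q l ih =>
    rw [queryOp, List.foldl_cons]
    exact (ih _).trans ((O q).norm_map v)

theorem cost_map_query {W : Type} [Fintype W] (l : List Q) :
    cost (l.map (Step.query : Q → Step R Q C W)) = l.length := by
  induction l with
  | nil => rfl
  | cons q l ih => rw [List.map_cons, cost_query_cons, ih, List.length_cons]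

/-- The flag state with amplitude `√p` on `true`. -/
def flagKet (p : ℝ) : Ket Bool :=
  WithLp.toLp 2 fun b => if b then ((√p : ℝ) : ℂ) else ((√(1 - p) : ℝ) : ℂ)

theorem norm_flagKet {p : ℝ} (h0 : 0 ≤ p) (h1 : p ≤ 1) : ‖flagKet p‖ = 1 := by
  rw [← sq_eq_sq₀ (norm_nonneg _) zero_le_one, EuclideanSpace.norm_sq_eq]
  simp [flagKet, abs_of_nonneg, Real.sqrt_nonneg, Real.sq_sqrt h0, Real.sq_sqrt (sub_nonneg.2 h1)]

/-- Rotation of the flag by an angle given by `φ` of the query register. -/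
def flagRot (φ : R → ℝ) : Ket (R × Bool) ≃ₗᵢ[ℂ] Ket (R × Bool) :=
  actOn (Equiv.prodComm R Bool) fun r => prepare false (flagKet (φ r))

/-- Queries `ps` followed by the rotation of the flag. -/
def flagPrep (ps : List Q) (φ : C → R → ℝ) : List (Step R Q C Bool) :=
  ps.map .query ++ [.free fun c => flagRot (φ c)]

/-- The inverse of `flagPrep ps φ`, if `qs` undoes `ps`. -/
def flagUnprep (qs : List Q) (φ : C → R → ℝ) : List (Step R Q C Bool) :=
  .free (fun c => (flagRot (φ c)).symm) :: qs.map .query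

variable {O : Q → Ket R ≃ₗᵢ[ℂ] Ket R} {ps qs : List Q} (c : C)

theorem run_flagUnprep (hO : ∀ v, queryOp O qs (queryOp O ps v) = v) (φ : C → R → ℝ)
    (Ψ : Ket (R × Bool)) :
    run O c (flagUnprep qs φ) Ψ = (run O c (flagPrep ps φ)).symm Ψ := by
  -- Every vector is in the range of the preparation, so it suffices that `qs` undoes `ps` on the
  -- left.
  obtain ⟨Φ, rfl⟩ := (run O c (flagPrep ps φ)).surjective Ψ
  rw [LinearIsometryEquiv.symm_apply_apply, flagPrep, run_append, run_cons, run_nil, flagUnprep,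
    run_cons]
  simp only [Step.op, LinearIsometryEquiv.symm_apply_apply]
  refine slice_ext (Equiv.refl _) fun w => ?_
  rw [slice_run_query, slice_run_query, hO]

variable [DecidableEq R] (r₀ : R)

theorem run_flagPrep_single (φ : C → R → ℝ) (h0 : ∀ r, 0 ≤ φ c r) (h1 : ∀ r, φ c r ≤ 1)
    (r : R) (b : Bool) :
    run O c (flagPrep ps φ) (EuclideanSpace.single (r₀, false) 1) (r, b) =
      queryOp O ps (EuclideanSpace.single r₀ 1) r * flagKet (φ c r) b := by
  have hs : ∀ w, slice (Equiv.refl (R × Bool)) w (EuclideanSpace.single (r₀, false) 1) =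
      if w then 0 else EuclideanSpace.single r₀ 1 := by
    intro w
    ext r
    cases w <;> simp [PiLp.single_apply]
  have hq : ∀ w, run O c (ps.map Step.query) (EuclideanSpace.single (r₀, false) 1) (r, w) =
      if w then 0 else queryOp O ps (EuclideanSpace.single r₀ 1) r := by
    intro w
    have := congrArg (fun v : Ket R => v r)
      (slice_run_query O c ps (EuclideanSpace.single (r₀, false) 1) w)
    rw [hs] at this
    simp only [slice_apply, Equiv.refl_symm, Equiv.refl_apply] at this
    rw [this]
    cases w
    · rfl
    · simp [queryOp_zero]
  rw [flagPrep, run_append, run_cons, run_nil]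
  simp only [Step.op, flagRot, actOn_apply, Equiv.prodComm_apply, Prod.swap_prod_mk]
  have : slice (Equiv.prodComm R Bool) r
      (run O c (ps.map Step.query) (EuclideanSpace.single (r₀, false) 1)) =
      queryOp O ps (EuclideanSpace.single r₀ 1) r • EuclideanSpace.single false 1 := by
    ext b
    simp only [slice_apply, Equiv.prodComm_symm, Equiv.prodComm_apply, Prod.swap_prod_mk, hq]
    cases b <;> simp
  rw [this, map_smul, prepare_single _ (norm_flagKet (h0 r) (h1 r))]
  rfl

/-- The sign change on the flagged basis vectors. -/
def flagSign (R : Type) [Fintype R] : Ket (R × Bool) ≃ₗᵢ[ℂ] Ket (R × Bool) :=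
  signFlip fun b => b.2 = true

/-- The probability that the flag is set. -/
def flagProb (O : Q → Ket R ≃ₗᵢ[ℂ] Ket R) (ps : List Q) (r₀ : R) (φ : R → ℝ) : ℝ :=
  ∑ r, ‖queryOp O ps (EuclideanSpace.single r₀ 1) r‖ ^ 2 * φ r

/-- The expectation of `Z` is the unflagged minus the flagged probability; the rotation splits each
weight into `1 - φ` and `φ`. -/
theorem inner_flagPrep (φ : C → R → ℝ) (h0 : ∀ r, 0 ≤ φ c r) (h1 : ∀ r, φ c r ≤ 1) :
    inner ℂ (run O c (flagPrep ps φ) (EuclideanSpace.single (r₀, false) 1))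
      (flagSign R (run O c (flagPrep ps φ) (EuclideanSpace.single (r₀, false) 1))) =
      ((1 - 2 * flagProb O ps r₀ (φ c) : ℝ) : ℂ) := by
  have hn : ∑ r, ‖queryOp O ps (EuclideanSpace.single r₀ 1) r‖ ^ 2 = 1 := by
    rw [← EuclideanSpace.norm_sq_eq, norm_queryOp]
    simp
  rw [flagProb, ← hn, Finset.mul_sum, ← Finset.sum_sub_distrib, PiLp.inner_apply,
    Fintype.sum_prod_type, Complex.ofReal_sum]
  refine Finset.sum_congr rfl fun r _ => ?_
  rw [Fintype.sum_bool]
  simp only [flagSign, signFlip_apply, run_flagPrep_single c r₀ φ h0 h1, flagKet, if_true,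
    RCLike.inner_apply]
  set z := queryOp O ps (EuclideanSpace.single r₀ 1) r
  have e1 : ((√(φ c r) : ℝ) : ℂ) * ((√(φ c r) : ℝ) : ℂ) = (φ c r : ℂ) := by
    rw [← Complex.ofReal_mul, Real.mul_self_sqrt (h0 r)]
  have e2 : ((√(1 - φ c r) : ℝ) : ℂ) * ((√(1 - φ c r) : ℝ) : ℂ) = 1 - (φ c r : ℂ) := by
    rw [← Complex.ofReal_mul, Real.mul_self_sqrt (sub_nonneg.2 (h1 r))]
    simp
  have e3 : z * (starRingEnd ℂ) z = ((‖z‖ ^ 2 : ℝ) : ℂ) := by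
    rw [Complex.mul_conj, Complex.normSq_eq_norm_sq]
  simp only [map_mul, Complex.conj_ofReal, Bool.false_eq_true, if_false]
  rw [Complex.ofReal_sub, Complex.ofReal_mul, Complex.ofReal_mul, ← e3]
  push_cast
  linear_combination -(z * (starRingEnd ℂ) z) * e1 + (z * (starRingEnd ℂ) z) * e2

/-- The circuit of `flagPrep`, followed by `κ c` iterations (as far as `κ c ≤ N`). -/
def groverCircuit (ps qs : List Q) (φ : C → R → ℝ) (κ : C → ℕ) (N : ℕ) :
    List (Step R Q C Bool) :=
  flagPrep ps φ ++ (List.range N).flatMap fun j =>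
    .free (fun c => if j < κ c then flagSign R else LinearIsometryEquiv.refl ℂ _) ::
      (flagUnprep qs φ ++
        .free (fun c => if j < κ c then signFlip fun b => b ≠ (r₀, false)
          else LinearIsometryEquiv.refl ℂ _) :: flagPrep ps φ)

theorem cost_groverCircuit (φ : C → R → ℝ) (κ : C → ℕ) (N : ℕ) :
    cost (groverCircuit r₀ ps qs φ κ N) = ps.length + N * (ps.length + qs.length) := by
  have h1 : cost (flagPrep ps φ) = ps.length := by
    rw [flagPrep, cost_append, cost_map_query, cost_free_cons]
    rfl
  have h2 : cost (flagUnprep qs φ) = qs.length := by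
    rw [flagUnprep, cost_free_cons, cost_map_query]
  rw [groverCircuit, cost_append, h1]
  congr 1
  induction N with
  | zero => simp [cost]
  | succ N ih =>
    rw [List.range_succ, List.flatMap_append, cost_append, ih, List.flatMap_cons, List.flatMap_nil,
      List.append_nil, cost_free_cons, cost_append, h2, cost_free_cons, h1]
    ring

/-- All `N` rounds are executed for every value of the control. In a round with `j ≥ κ c` both
reflections become the identity, and the inverse preparation cancels against the preparation; hence
only free steps need a control. -/
theorem run_groverCircuit (hO : ∀ v, queryOp O qs (queryOp O ps v) = v) (φ : C → R → ℝ)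
    (κ : C → ℕ) {N : ℕ} (hN : κ c ≤ N) :
    run O c (groverCircuit r₀ ps qs φ κ N) (EuclideanSpace.single (r₀, false) 1) =
      groverOrbit (run O c (flagPrep ps φ)) (flagSign R) (r₀, false) (κ c + 1) := by
  have hZ : ∀ v, flagSign R (flagSign R v) = v := signFlip_signFlip _
  rw [groverOrbit_succ _ _ _ hZ, groverCircuit, run_append]
  generalize run O c (flagPrep ps φ) (EuclideanSpace.single (r₀, false) 1) = Ψ
  have key : ∀ m, run O c ((List.range m).flatMap fun j =>
      .free (fun c => if j < κ c then flagSign R else LinearIsometryEquiv.refl ℂ _) ::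
        (flagUnprep qs φ ++
          .free (fun c => if j < κ c then signFlip fun b => b ≠ (r₀, false)
            else LinearIsometryEquiv.refl ℂ _) :: flagPrep ps φ)) Ψ =
      (groverIter (run O c (flagPrep ps φ)) (flagSign R) (r₀, false))^[min m (κ c)] Ψ := by
    intro m
    induction m with
    | zero => simp [run_nil]
    | succ m ih =>
      rw [List.range_succ, List.flatMap_append, run_append, ih, List.flatMap_cons,
        List.flatMap_nil, List.append_nil, run_cons, run_append, run_flagUnprep c hO, run_cons]
      by_cases h : m < κ c
      · rw [min_eq_left (by omega : m ≤ κ c), min_eq_left (by omega : m + 1 ≤ κ c),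
          Function.iterate_succ_apply']
        simp only [Step.op, if_pos h]
        rfl
      · rw [min_eq_right (by omega : κ c ≤ m), min_eq_right (by omega : κ c ≤ m + 1)]
        simp only [Step.op, if_neg h, LinearIsometryEquiv.coe_refl, id,
          LinearIsometryEquiv.apply_symm_apply]
  rw [key, min_eq_right hN]

/-- The normalized window state of the counter. -/
def windowKet (N : ℕ) : Ket (Fin N) :=
  WithLp.toLp 2 fun k => ((window N (k + 1) / √(∑ k : Fin N, window N (k + 1) ^ 2) : ℝ) : ℂ)

theorem norm_windowKet {N : ℕ} (hN : 0 < N) : ‖windowKet N‖ = 1 := by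
  have h := pow_five_le_sum_window_sq N
  have hp : (0 : ℝ) < (N : ℝ) ^ 5 := by positivity
  have hS : 0 < ∑ k : Fin N, window N (k + 1) ^ 2 := by linarith
  rw [← sq_eq_sq₀ (norm_nonneg _) zero_le_one, EuclideanSpace.norm_sq_eq]
  simp only [windowKet, Complex.norm_real, Real.norm_eq_abs, sq_abs, div_pow, Real.sq_sqrt hS.le]
  rw [← Finset.sum_div, div_self hS.ne', one_pow]

/-- Regrouping that singles out the counter. -/
def counterEquiv (R : Type) (N : ℕ) : R × Fin N × Bool ≃ Fin N × R × Bool :=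
  ⟨fun b => (b.2.1, b.1, b.2.2), fun b => (b.2.1, b.1, b.2.2), fun _ => rfl, fun _ => rfl⟩

/-- Amplitude estimation with a counter of `t` qubits: an estimate of `s` times the probability
that the flag is set. -/
def amplitudeEstimation (ps qs : List Q) (φ : C → R → ℝ) (t : ℕ) (s : ℝ) :
    Procedure R Q C ℝ where
  W := Fin (2 ^ t) × Bool
  init := (⟨0, by positivity⟩, false)
  size := t + 1
  card_eq := by simp [pow_succ]
  steps := .free (fun _ => actOn (counterEquiv R (2 ^ t)) fun _ =>
      prepare ⟨0, by positivity⟩ (windowKet (2 ^ t))) ::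
    ((groverCircuit r₀ ps qs (fun c : C × Fin (2 ^ t) => φ c.1) (fun c => c.2) (2 ^ t)).map
      (Step.lift (Equiv.refl _) Prod.mk) ++
    [.free fun _ => actOn (counterEquiv R (2 ^ t)) fun _ =>
      (pathMatrix_isHermitian (2 ^ t)).eigenvectorBasis.repr])
  out b := s * ((1 - (pathMatrix_isHermitian (2 ^ t)).eigenvalues b.2.1) / 2)

theorem cost_amplitudeEstimation (φ : C → R → ℝ) (t : ℕ) (s : ℝ) :
    cost (amplitudeEstimation r₀ ps qs φ t s).steps =
      ps.length + 2 ^ t * (ps.length + qs.length) := by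
  unfold amplitudeEstimation
  rw [cost_free_cons, cost_append, cost_free_cons, cost_map_lift, cost_groverCircuit]
  rfl

theorem final_amplitudeEstimation (hO : ∀ v, queryOp O qs (queryOp O ps v) = v) (φ : C → R → ℝ)
    (t : ℕ) (s : ℝ) (r : R) (y : Fin (2 ^ t)) (b : Bool) :
    (amplitudeEstimation r₀ ps qs φ t s).final O r₀ c (r, y, b) =
      (pathMatrix_isHermitian (2 ^ t)).eigenvectorBasis.repr (WithLp.toLp 2 fun k =>
        windowKet (2 ^ t) k *
          groverOrbit (run O c (flagPrep ps φ)) (flagSign R) (r₀, false) (k + 1) (r, b)) y := by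
  have hpos : 0 < 2 ^ t := by positivity
  set Ψ₁ : Ket (R × Fin (2 ^ t) × Bool) := actOn (counterEquiv R (2 ^ t)) (fun _ =>
      prepare ⟨0, hpos⟩ (windowKet (2 ^ t))) (EuclideanSpace.single (r₀, ⟨0, hpos⟩, false) 1) with hΨ₁
  have h₁ : ∀ k, slice (spectatorEquiv R (Equiv.refl (Fin (2 ^ t) × Bool))) k Ψ₁ =
      windowKet (2 ^ t) k • EuclideanSpace.single (r₀, false) 1 := by
    intro k
    ext ⟨r, b⟩
    have hs : slice (counterEquiv R (2 ^ t)) (r, b) (EuclideanSpace.single (r₀, ⟨0, hpos⟩, false) 1) =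
        (if (r, b) = (r₀, false) then (1 : ℂ) else 0) • EuclideanSpace.single ⟨0, hpos⟩ 1 := by
      ext k
      simp only [slice_apply, counterEquiv, Equiv.coe_fn_symm_mk, PiLp.single_apply,
        PiLp.smul_apply, smul_eq_mul, Prod.ext_iff]
      split_ifs <;> simp_all
    have := congrArg (fun v : Ket (Fin (2 ^ t)) => v k) (slice_actOn (counterEquiv R (2 ^ t))
      (fun _ => prepare ⟨0, hpos⟩ (windowKet (2 ^ t))) (EuclideanSpace.single (r₀, ⟨0, hpos⟩, false) 1)
      (r, b))
    rw [hs, map_smul, prepare_single _ (norm_windowKet hpos)] at this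
    simp only [slice_apply, PiLp.smul_apply, smul_eq_mul] at this
    simp only [slice_apply, PiLp.smul_apply, smul_eq_mul, PiLp.single_apply]
    rw [mul_comm]
    exact this
  set Ψ₂ := run O c ((groverCircuit r₀ ps qs (fun c : C × Fin (2 ^ t) => φ c.1) (fun c => c.2) (2 ^ t)).map
      (Step.lift (Equiv.refl _) Prod.mk)) Ψ₁ with hΨ₂
  -- The preparation ignores the counter, so all branches share the same Grover iteration.
  have hA : ∀ k : Fin (2 ^ t), run O (c, k) (flagPrep ps fun c : C × Fin (2 ^ t) => φ c.1) =
      run O c (flagPrep ps φ) := by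
    intro k
    ext1 Ψ
    simp only [flagPrep, run_append]
    have : ∀ (l : List Q) (Ψ : Ket (R × Bool)),
        run O (c, k) (l.map Step.query) Ψ = run O c (l.map Step.query) Ψ := by
      intro l
      induction l with
      | nil => exact fun _ => rfl
      | cons q l ih => exact fun Ψ => ih _
    rw [this]
    rfl
  have h₂ : ∀ k : Fin (2 ^ t), slice (spectatorEquiv R (Equiv.refl (Fin (2 ^ t) × Bool))) k Ψ₂ =
      windowKet (2 ^ t) k • groverOrbit (run O c (flagPrep ps φ)) (flagSign R) (r₀, false) (k + 1) := by
    intro k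
    rw [hΨ₂, slice_run_lift, h₁, map_smul, run_groverCircuit (c, k) r₀ hO _ _ k.2.le, hA]
  have h₃ : (amplitudeEstimation r₀ ps qs φ t s).final O r₀ c =
      actOn (counterEquiv R (2 ^ t)) (fun _ =>
        (pathMatrix_isHermitian (2 ^ t)).eigenvectorBasis.repr) Ψ₂ := by
    unfold Procedure.final amplitudeEstimation
    rw [run_cons, run_append, run_cons, run_nil]
    rfl
  rw [h₃]
  have h₄ : slice (counterEquiv R (2 ^ t)) (r, b) Ψ₂ = WithLp.toLp 2 fun k : Fin (2 ^ t) => windowKet (2 ^ t) k *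
      groverOrbit (run O c (flagPrep ps φ)) (flagSign R) (r₀, false) (k + 1) (r, b) := by
    ext k
    exact congrArg (fun v : Ket (R × Bool) => v (r, b)) (h₂ k)
  change (pathMatrix_isHermitian (2 ^ t)).eigenvectorBasis.repr (slice (counterEquiv R (2 ^ t)) (r, b) Ψ₂) y = _
  rw [h₄]

theorem flagProb_nonneg {φ : R → ℝ} (h0 : ∀ r, 0 ≤ φ r) : 0 ≤ flagProb O ps r₀ φ :=
  Finset.sum_nonneg fun r _ => mul_nonneg (by positivity) (h0 r)

theorem flagProb_le_one {φ : R → ℝ} (h1 : ∀ r, φ r ≤ 1) : flagProb O ps r₀ φ ≤ 1 := by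
  have hn : ∑ r, ‖queryOp O ps (EuclideanSpace.single r₀ 1) r‖ ^ 2 = 1 := by
    rw [← EuclideanSpace.norm_sq_eq, norm_queryOp]
    simp
  rw [← hn]
  exact Finset.sum_le_sum fun r _ => mul_le_of_le_one_right (by positivity) (h1 r)

/-- The window has squared norm at least `N⁵/30`, while its first and second differences contribute
`N³(1 - c²)` and `N` up to constants. The resulting factor `flagProb` in the leading term is what
lets the errors of the dyadic layers be summed. -/
theorem expect_amplitudeEstimation_le (hO : ∀ v, queryOp O qs (queryOp O ps v) = v)
    (φ : C → R → ℝ) (h0 : ∀ r, 0 ≤ φ c r) (h1 : ∀ r, φ c r ≤ 1) (t : ℕ) (s : ℝ) :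
    (amplitudeEstimation r₀ ps qs φ t s).expect O r₀ c
        (fun w => (w - s * flagProb O ps r₀ (φ c)) ^ 2) ≤
      s ^ 2 * (60 * flagProb O ps r₀ (φ c) / (2 ^ t) ^ 2 + 15 / (2 ^ t) ^ 4) := by
  set a := flagProb O ps r₀ (φ c) with ha
  set N := 2 ^ t with hN
  have hpos : 0 < N := by positivity
  set y := groverOrbit (run O c (flagPrep ps φ)) (flagSign R) (r₀, false)
  set S := ∑ k : Fin N, window N (k + 1) ^ 2 with hS
  set lam := (pathMatrix_isHermitian N).eigenvalues
  set χ : R × Bool → Ket (Fin N) := fun b =>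
    WithLp.toLp 2 fun k => windowKet N k * y (k + 1) b with hχ
  have hS5 : (N : ℝ) ^ 5 ≤ 30 * S := pow_five_le_sum_window_sq N
  have hN0 : (0 : ℝ) < N := by exact_mod_cast hpos
  have hS0 : 0 < S := by
    have : (0 : ℝ) < (N : ℝ) ^ 5 := by positivity
    linarith
  have ha0 : 0 ≤ a := flagProb_nonneg r₀ h0
  have ha1 : a ≤ 1 := flagProb_le_one r₀ h1
  -- With `λ` the measured eigenvalue, the error is `-s(λ - c)/2` for `c = 1 - 2a`, whence the
  -- factor `s²/4`.
  have e1 : (amplitudeEstimation r₀ ps qs φ t s).expect O r₀ c (fun w => (w - s * a) ^ 2) =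
      s ^ 2 / 4 * ∑ b : R × Bool, ∑ k : Fin N,
        ‖(pathMatrix N *ᵥ χ b) k - ((1 - 2 * a : ℝ) : ℂ) * χ b k‖ ^ 2 := by
    simp_rw [← fun b => sum_norm_sq_eigenvectorBasis_repr (pathMatrix_isHermitian N) (χ b)
      (1 - 2 * a), Finset.mul_sum]
    unfold Procedure.expect
    change ∑ b : R × Fin N × Bool, _ = _
    rw [Fintype.sum_prod_type, Fintype.sum_prod_type]
    refine Finset.sum_congr rfl fun r _ => ?_
    rw [Fintype.sum_prod_type, Finset.sum_comm]
    refine Finset.sum_congr rfl fun f _ => Finset.sum_congr rfl fun k _ => ?_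
    refine (congrArg (fun z : ℂ => ‖z‖ ^ 2 * (s * ((1 - lam k) / 2) - s * a) ^ 2)
      (final_amplitudeEstimation c r₀ hO φ t s r k f)).trans ?_
    change ‖(pathMatrix_isHermitian N).eigenvectorBasis.repr (χ (r, f)) k‖ ^ 2 *
      (s * ((1 - lam k) / 2) - s * a) ^ 2 = _
    ring
  have e2 : ∀ (b : R × Bool) (k : Fin N),
      ‖(pathMatrix N *ᵥ χ b) k - ((1 - 2 * a : ℝ) : ℂ) * χ b k‖ ^ 2 =
        1 / S * ‖((1 / 2 : ℝ) • (window N k • y k + window N (k + 2) • y (k + 2)) -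
          ((1 - 2 * a) * window N (k + 1)) • y (k + 1)) b‖ ^ 2 := by
    intro b k
    have hp := pathMatrix_mulVec (N := N) (fun j => ((window N j / √S : ℝ) : ℂ) * y j b)
      (by simp [window]) (by simp [window]) k
    have hp' : (pathMatrix N *ᵥ χ b) k = _ := hp
    have : 1 / S = ‖((1 / √S : ℝ) : ℂ)‖ ^ 2 := by
      rw [Complex.norm_real, Real.norm_eq_abs, sq_abs, div_pow, Real.sq_sqrt hS0.le, one_pow]
    rw [hp', this, ← mul_pow, ← norm_mul]
    congr 2
    simp only [hχ, windowKet, PiLp.sub_apply, PiLp.smul_apply, PiLp.add_apply, ← hS,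
      Complex.real_smul]
    push_cast
    ring
  have e3 := sum_norm_sq_window_orbit_le (run O c (flagPrep ps φ)) (flagSign R) (r₀, false)
    (signFlip_signFlip _) (1 - 2 * a) (inner_flagPrep c r₀ φ h0 h1) (by nlinarith) N
  rw [e1]
  simp_rw [e2]
  rw [Finset.sum_comm]
  simp_rw [← Finset.mul_sum, ← EuclideanSpace.norm_sq_eq]
  calc _ ≤ s ^ 2 / 4 * (1 / S * (2 * (1 - (1 - 2 * a) ^ 2) * N ^ 3 + 2 * N)) := by gcongr
    _ ≤ s ^ 2 / 4 * (30 / N ^ 5 * (8 * a * N ^ 3 + 2 * N)) := by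
        -- This is `1 - c² = 4a(1 - a) ≤ 4a`.
        have hb : 2 * (1 - (1 - 2 * a) ^ 2) ≤ 8 * a := by nlinarith
        have hc : 1 / S ≤ 30 / N ^ 5 := by
          rw [div_le_div_iff₀ hS0 (by positivity)]
          linarith
        have hd : 0 ≤ 2 * (1 - (1 - 2 * a) ^ 2) := by nlinarith
        gcongr
    _ = s ^ 2 * (60 * a / (N : ℝ) ^ 2 + 15 / (N : ℝ) ^ 4) := by
        field_simp
        ring
    _ = _ := by
        rw [hN]
        push_cast
        rfl

end AmplitudeEstimation

/-! ### Dyadic truncation -/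

/-- The positive part of `v`, cut off at `2 ^ (l - 1) * D` (and `0` if `l = 0`). -/
def trunc (D : ℝ) : ℕ → ℝ → ℝ
  | 0, _ => 0
  | l + 1, v => min (max v 0) (2 ^ l * D)

/-- The part of the positive part of `v` between two dyadic thresholds, scaled to `[0, 1]`. -/
def level (D : ℝ) (l : ℕ) (v : ℝ) : ℝ := (trunc D (l + 1) v - trunc D l v) / (2 ^ l * D)

section Level

variable {D : ℝ}


theorem trunc_nonneg (hD : 0 < D) (l : ℕ) (v : ℝ) : 0 ≤ trunc D l v := by
  cases l with
  | zero => exact le_rfl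
  | succ l => exact le_min (le_max_right _ _) (by positivity)

theorem trunc_le_succ (hD : 0 < D) (l : ℕ) (v : ℝ) : trunc D l v ≤ trunc D (l + 1) v := by
  cases l with
  | zero => exact trunc_nonneg hD _ _
  | succ l =>
    refine min_le_min_left _ ?_
    rw [pow_succ]
    nlinarith [show 0 < 2 ^ l * D by positivity]

theorem trunc_sq_le (hD : 0 < D) (l : ℕ) (v : ℝ) : trunc D l v ^ 2 ≤ v ^ 2 := by
  rw [← sq_abs v]
  refine pow_le_pow_left₀ (trunc_nonneg hD _ _) ?_ 2
  cases l with
  | zero => exact abs_nonneg v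
  | succ l => exact (min_le_left _ _).trans (max_le (le_abs_self v) (abs_nonneg v))

theorem level_nonneg (hD : 0 < D) (l : ℕ) (v : ℝ) : 0 ≤ level D l v :=
  div_nonneg (sub_nonneg.2 (trunc_le_succ hD l v)) (by positivity)

theorem level_le_one (hD : 0 < D) (l : ℕ) (v : ℝ) : level D l v ≤ 1 := by
  refine div_le_one_of_le₀ ?_ (by positivity)
  have : trunc D (l + 1) v ≤ 2 ^ l * D := min_le_right _ _
  linarith [trunc_nonneg hD l v]

theorem sum_mul_level (hD : 0 < D) (J : ℕ) (v : ℝ) :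
    ∑ l ∈ Finset.range J, 2 ^ l * D * level D l v = trunc D J v := by
  induction J with
  | zero => rfl
  | succ J ih =>
    rw [Finset.sum_range_succ, ih, level, mul_div_cancel₀ _ (by positivity)]
    ring

/-- A layer of scale `2^l D` with `l ≥ 1` is nonzero only where `v` exceeds half that scale, so its
weighted size is dominated by an increment of the squared truncation, and these telescope. The
lowest layer accounts for `D²`. -/
theorem sum_sq_mul_level_le (hD : 0 < D) (J : ℕ) (v : ℝ) :
    ∑ l ∈ Finset.range J, (2 ^ l * D) ^ 2 * level D l v ≤ D ^ 2 + 2 * v ^ 2 := by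
  suffices h : ∑ l ∈ Finset.range J, (2 ^ l * D) ^ 2 * level D l v ≤ D ^ 2 + 2 * trunc D J v ^ 2 by
    linarith [trunc_sq_le hD J v]
  have e : ∀ l, (2 ^ l * D) ^ 2 * level D l v =
      2 ^ l * D * (trunc D (l + 1) v - trunc D l v) := by
    intro l
    have : 2 ^ l * D ≠ 0 := by positivity
    rw [level]
    field_simp
  induction J with
  | zero => simp [trunc, sq_nonneg]
  | succ J ih =>
    rw [Finset.sum_range_succ, e]
    cases J with
    | zero =>
      have h1 : trunc D 1 v ≤ D := (min_le_right _ _).trans_eq (by simp)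
      have h0 : trunc D 0 v = 0 := rfl
      rw [h0]
      norm_num
      nlinarith [sq_nonneg (trunc D 1 v)]
    | succ J =>
      have hp : 0 < 2 ^ J * D := by positivity
      have h2 : (2 : ℝ) ^ (J + 1) * D = 2 * (2 ^ J * D) := by ring
      have h1 : trunc D (J + 1 + 1) v = min (max v 0) (2 * (2 ^ J * D)) := by rw [← h2]; rfl
      have h0 : trunc D (J + 1) v = min (max v 0) (2 ^ J * D) := rfl
      -- If the increment is nonzero, both truncations are at least `2 ^ J * D`, so their sum is at
      -- least `2 * (2 ^ J * D)`.
      have key : 2 * (2 ^ J * D) * (trunc D (J + 1 + 1) v - trunc D (J + 1) v) ≤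
          2 * (trunc D (J + 1 + 1) v ^ 2 - trunc D (J + 1) v ^ 2) := by
        rw [h1, h0]
        rcases le_total (max v 0) (2 ^ J * D) with h | h
        · rw [min_eq_left h, min_eq_left (by linarith)]
          simp
        · rw [min_eq_right h]
          have : 2 ^ J * D ≤ min (max v 0) (2 * (2 ^ J * D)) := le_min h (by linarith)
          nlinarith
      rw [h2]
      linarith

/-- Beyond a threshold `T`, the excess `u - T` is at most `u ≤ u²/T`. -/
theorem abs_sub_trunc_le (hD : 0 < D) (K : ℕ) (v : ℝ) :
    |v - (trunc D (K + 1) v - trunc D (K + 1) (-v))| ≤ v ^ 2 / (2 ^ K * D) := by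
  have hT : 0 < 2 ^ K * D := by positivity
  have key : ∀ u : ℝ, 0 ≤ u → |u - min u (2 ^ K * D)| ≤ u ^ 2 / (2 ^ K * D) := by
    intro u hu
    rcases le_total u (2 ^ K * D) with h | h
    · rw [min_eq_left h, sub_self, abs_zero]
      positivity
    · rw [min_eq_right h, abs_of_nonneg (sub_nonneg.2 h), le_div_iff₀ hT]
      nlinarith
  change |v - (min (max v 0) (2 ^ K * D) - min (max (-v) 0) (2 ^ K * D))| ≤ _
  rcases le_total 0 v with h | h
  · rw [max_eq_left h, max_eq_right (by linarith), min_eq_left hT.le, sub_zero]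
    exact key v h
  · rw [max_eq_right h, max_eq_left (by linarith), min_eq_left hT.le, zero_sub, sub_neg_eq_add,
      ← abs_neg, neg_add', ← neg_sq]
    exact key (-v) (by linarith)

end Level

/-! ### Estimation of a mean -/

section Mean

variable {R Q C : Type} [Fintype R] [DecidableEq R] {O : Q → Ket R ≃ₗᵢ[ℂ] Ket R} {ps qs : List Q}
  (r₀ : R) (size : ℕ) (hsize : Fintype.card R = 2 ^ size)

/-- The sum of the outcomes of the procedures `P j` for `j < J`. -/
def sumProcedure (P : ℕ → Procedure R Q C ℝ) : ℕ → Procedure R Q C ℝ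
  | 0 => { W := Unit, init := (), size := 0, card_eq := rfl, steps := [], out := fun _ => 0 }
  | J + 1 => (sumProcedure P J).bind (P J) r₀ (fun c _ => c) (fun x y => x + y) size hsize

theorem cost_sumProcedure (P : ℕ → Procedure R Q C ℝ) (q : ℕ) (hq : ∀ j, cost (P j).steps = q)
    (J : ℕ) : cost (sumProcedure r₀ size hsize P J).steps = J * q := by
  induction J with
  | zero => rw [Nat.zero_mul]; rfl
  | succ J ih => rw [sumProcedure, Procedure.cost_bind, ih, hq]; ring

/-- The summands may be biased, so cross terms need not vanish. They are absorbed by a weighted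
square inequality with weights `(J+2)/(J+1)` and `J+2`, chosen so that the factor grows only
linearly in the number of terms. -/
theorem expect_sumProcedure_le (c : C) (P : ℕ → Procedure R Q C ℝ) (s e : ℕ → ℝ)
    (h : ∀ j, (P j).expect O r₀ c (fun w => (w - s j) ^ 2) ≤ e j) (J : ℕ) :
    (sumProcedure r₀ size hsize P J).expect O r₀ c
      (fun w => (w - ∑ j ∈ Finset.range J, s j) ^ 2) ≤ (J + 1) * ∑ j ∈ Finset.range J, e j := by
  induction J with
  | zero => simp [sumProcedure, Procedure.expect]
  | succ J ih =>
    rw [sumProcedure, Procedure.expect_bind]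
    set S := ∑ j ∈ Finset.range J, s j
    have hJ : (0 : ℝ) < J + 1 := by positivity
    have h1 : ∀ x y : ℝ, (x + y - ∑ j ∈ Finset.range (J + 1), s j) ^ 2 ≤
        ((J : ℝ) + 2) / (J + 1) * (x - S) ^ 2 + ((J : ℝ) + 2) * (y - s J) ^ 2 := by
      intro x y
      rw [Finset.sum_range_succ, ← sub_nonneg]
      have : ((J : ℝ) + 2) / (J + 1) * (x - S) ^ 2 + ((J : ℝ) + 2) * (y - s J) ^ 2 -
          (x + y - (S + s J)) ^ 2 = ((x - S) - (J + 1) * (y - s J)) ^ 2 / (J + 1) := by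
        field_simp
        ring
      rw [this]
      positivity
    have h2 : ∀ x, (P J).expect O r₀ c (fun y => (x + y - ∑ j ∈ Finset.range (J + 1), s j) ^ 2) ≤
        ((J : ℝ) + 2) * e J + ((J : ℝ) + 2) / (J + 1) * (x - S) ^ 2 := by
      intro x
      refine ((P J).expect_mono O r₀ c (h1 x)).trans ?_
      rw [Procedure.expect_add, Procedure.expect_const, Procedure.expect_const_mul]
      have := mul_le_mul_of_nonneg_left (h J) (show (0 : ℝ) ≤ (J : ℝ) + 2 by positivity)
      linarith
    refine (Procedure.expect_mono O r₀ c _ h2).trans ?_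
    rw [Procedure.expect_add, Procedure.expect_const, Procedure.expect_const_mul,
      Finset.sum_range_succ]
    have h3 : ((J : ℝ) + 2) / (J + 1) * (sumProcedure r₀ size hsize P J).expect O r₀ c
        (fun w => (w - S) ^ 2) ≤ ((J : ℝ) + 2) / (J + 1) *
          ((J + 1) * ∑ j ∈ Finset.range J, e j) :=
      mul_le_mul_of_nonneg_left ih (by positivity)
    rw [← mul_assoc, div_mul_cancel₀ _ hJ.ne'] at h3
    push_cast
    linarith

variable (ps qs) in
/-- An estimate of the mean of the truncated positive part of `σ * (val r - ctr c)`. -/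
def partEstimate (val : R → ℝ) (ctr : C → ℝ) (σ D : ℝ) (t J : ℕ) : Procedure R Q C ℝ :=
  sumProcedure r₀ size hsize (fun l => amplitudeEstimation r₀ ps qs
    (fun c r => level D l (σ * (val r - ctr c))) t (2 ^ l * D)) J

theorem sum_weight (O : Q → Ket R ≃ₗᵢ[ℂ] Ket R) (ps : List Q) :
    ∑ r, ‖queryOp O ps (EuclideanSpace.single r₀ 1) r‖ ^ 2 = 1 := by
  rw [← EuclideanSpace.norm_sq_eq, norm_queryOp]
  simp

theorem sum_mul_flagProb (w : ℕ → ℝ) (φ : ℕ → R → ℝ) (J : ℕ) :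
    ∑ l ∈ Finset.range J, w l * flagProb O ps r₀ (φ l) =
      flagProb O ps r₀ fun r => ∑ l ∈ Finset.range J, w l * φ l r := by
  unfold flagProb
  simp_rw [Finset.mul_sum]
  rw [Finset.sum_comm]
  exact Finset.sum_congr rfl fun r _ => Finset.sum_congr rfl fun l _ => by ring

theorem flagProb_mono {φ φ' : R → ℝ} (h : ∀ r, φ r ≤ φ' r) :
    flagProb O ps r₀ φ ≤ flagProb O ps r₀ φ' :=
  Finset.sum_le_sum fun r _ => mul_le_mul_of_nonneg_left (h r) (by positivity)

theorem flagProb_add_mul (x y : ℝ) (φ : R → ℝ) :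
    flagProb O ps r₀ (fun r => x + y * φ r) = x + y * flagProb O ps r₀ φ := by
  unfold flagProb
  simp_rw [mul_add, Finset.sum_add_distrib, ← Finset.sum_mul, sum_weight, Finset.mul_sum, one_mul]
  congr 1
  exact Finset.sum_congr rfl fun r _ => by ring

/-- The layers sum to the truncation. Their errors linear in the flag probability are controlled by
the second moment, and the remaining ones by the geometric sum of the squared scales. -/
theorem expect_partEstimate_le (hO : ∀ v, queryOp O qs (queryOp O ps v) = v) (val : R → ℝ)
    (ctr : C → ℝ) {σ D : ℝ} (hσ : σ ^ 2 = 1) (hD : 0 < D) (t K : ℕ) (c : C) :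
    (partEstimate ps qs r₀ size hsize val ctr σ D t (K + 1)).expect O r₀ c
      (fun w => (w - flagProb O ps r₀ fun r => trunc D (K + 1) (σ * (val r - ctr c))) ^ 2) ≤
    (K + 2) * (60 * (D ^ 2 + 2 * flagProb O ps r₀ fun r => (val r - ctr c) ^ 2) / (2 ^ t) ^ 2 +
      30 * (4 ^ K * D ^ 2) / (2 ^ t) ^ 4) := by
  have h1 := expect_sumProcedure_le (O := O) r₀ size hsize c
    (fun l => amplitudeEstimation r₀ ps qs (fun c r => level D l (σ * (val r - ctr c))) t
      (2 ^ l * D)) _ _ (fun l => expect_amplitudeEstimation_le c r₀ hO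
        (fun c r => level D l (σ * (val r - ctr c))) (fun r => level_nonneg hD _ _)
        (fun r => level_le_one hD _ _) t (2 ^ l * D)) (K + 1)
  rw [sum_mul_flagProb] at h1
  simp_rw [sum_mul_level hD] at h1
  refine h1.trans ?_
  have h2 : ∑ l ∈ Finset.range (K + 1), (2 ^ l * D) ^ 2 *
      flagProb O ps r₀ (fun r => level D l (σ * (val r - ctr c))) ≤
        D ^ 2 + 2 * flagProb O ps r₀ fun r => (val r - ctr c) ^ 2 := by
    rw [sum_mul_flagProb, ← flagProb_add_mul]
    refine flagProb_mono r₀ fun r => (sum_sq_mul_level_le hD _ _).trans ?_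
    rw [mul_pow, hσ, one_mul]
  have h3 : ∑ l ∈ Finset.range (K + 1), ((2 : ℝ) ^ l * D) ^ 2 ≤ 2 * (4 ^ K * D ^ 2) := by
    have : ∀ K : ℕ, ∑ l ∈ Finset.range (K + 1), ((2 : ℝ) ^ l * D) ^ 2 ≤ 2 * (4 ^ K * D ^ 2) := by
      intro K
      induction K with
      | zero => simp; nlinarith [sq_nonneg D]
      | succ K ih =>
        rw [Finset.sum_range_succ]
        have e1 : ((2 : ℝ) ^ (K + 1) * D) ^ 2 = 4 * (4 ^ K * D ^ 2) := by
          rw [mul_pow, ← pow_mul, mul_comm (K + 1) 2, pow_mul]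
          norm_num
          ring
        have e2 : (4 : ℝ) ^ (K + 1) * D ^ 2 = 4 * (4 ^ K * D ^ 2) := by ring
        have : (0 : ℝ) ≤ 4 ^ K * D ^ 2 := by positivity
        rw [e1, e2]
        linarith
    exact this K
  have h4 : ∑ l ∈ Finset.range (K + 1), (2 ^ l * D) ^ 2 *
      (60 * flagProb O ps r₀ (fun r => level D l (σ * (val r - ctr c))) / (2 ^ t) ^ 2 +
        15 / (2 ^ t) ^ 4) =
      60 / (2 ^ t) ^ 2 * (∑ l ∈ Finset.range (K + 1), (2 ^ l * D) ^ 2 *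
        flagProb O ps r₀ (fun r => level D l (σ * (val r - ctr c)))) +
      15 / (2 ^ t) ^ 4 * ∑ l ∈ Finset.range (K + 1), ((2 : ℝ) ^ l * D) ^ 2 := by
    rw [Finset.mul_sum, Finset.mul_sum, ← Finset.sum_add_distrib]
    exact Finset.sum_congr rfl fun l _ => by ring
  rw [h4]
  push_cast
  rw [show (K : ℝ) + 1 + 1 = K + 2 by ring]
  refine mul_le_mul_of_nonneg_left ?_ (by positivity)
  have h5 := mul_le_mul_of_nonneg_left h2 (show (0 : ℝ) ≤ 60 / (2 ^ t) ^ 2 by positivity)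
  have h6 := mul_le_mul_of_nonneg_left h3 (show (0 : ℝ) ≤ 15 / (2 ^ t) ^ 4 by positivity)
  refine (add_le_add h5 h6).trans (le_of_eq ?_)
  ring

variable (ps qs) in
/-- An estimate of the mean of `val r - ctr c`. -/
def shiftEstimate (val : R → ℝ) (ctr : C → ℝ) (D : ℝ) (t J : ℕ) : Procedure R Q C ℝ :=
  (partEstimate ps qs r₀ size hsize val ctr 1 D t J).bind
    (partEstimate ps qs r₀ size hsize val ctr (-1) D t J) r₀ (fun c _ => c) (fun x y => x - y)
    size hsize

theorem expect_shiftEstimate_le (hO : ∀ v, queryOp O qs (queryOp O ps v) = v) (val : R → ℝ)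
    (ctr : C → ℝ) {D : ℝ} (hD : 0 < D) (t K : ℕ) (c : C) :
    (shiftEstimate ps qs r₀ size hsize val ctr D t (K + 1)).expect O r₀ c
      (fun w => (w - flagProb O ps r₀ fun r =>
        trunc D (K + 1) (val r - ctr c) - trunc D (K + 1) (-(val r - ctr c))) ^ 2) ≤
    4 * ((K + 2) * (60 * (D ^ 2 + 2 * flagProb O ps r₀ fun r => (val r - ctr c) ^ 2) /
      (2 ^ t) ^ 2 + 30 * (4 ^ K * D ^ 2) / (2 ^ t) ^ 4)) := by
  have hp := expect_partEstimate_le r₀ size hsize hO val ctr (σ := 1) (by norm_num) hD t K c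
  have hn := expect_partEstimate_le r₀ size hsize hO val ctr (σ := -1) (by norm_num) hD t K c
  simp only [one_mul, neg_one_mul] at hp hn
  set a := flagProb O ps r₀ fun r => trunc D (K + 1) (val r - ctr c)
  set b := flagProb O ps r₀ fun r => trunc D (K + 1) (-(val r - ctr c))
  have hab : (flagProb O ps r₀ fun r =>
      trunc D (K + 1) (val r - ctr c) - trunc D (K + 1) (-(val r - ctr c))) = a - b := by
    simp only [a, b, flagProb, mul_sub, Finset.sum_sub_distrib]
  rw [hab, shiftEstimate, Procedure.expect_bind]
  set e := ((K : ℝ) + 2) * (60 * (D ^ 2 + 2 * flagProb O ps r₀ fun r => (val r - ctr c) ^ 2) /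
      (2 ^ t) ^ 2 + 30 * (4 ^ K * D ^ 2) / (2 ^ t) ^ 4)
  have h2 : ∀ x, (partEstimate ps qs r₀ size hsize val ctr (-1) D t (K + 1)).expect O r₀ c
      (fun y => (x - y - (a - b)) ^ 2) ≤ 2 * e + 2 * (x - a) ^ 2 := by
    intro x
    refine (Procedure.expect_mono O r₀ c _
      (G := fun y => 2 * (x - a) ^ 2 + 2 * (y - b) ^ 2) fun y => ?_).trans ?_
    · nlinarith [sq_nonneg ((x - a) + (y - b))]
    · rw [Procedure.expect_add, Procedure.expect_const, Procedure.expect_const_mul]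
      linarith
  refine (Procedure.expect_mono O r₀ c _ h2).trans ?_
  rw [Procedure.expect_add, Procedure.expect_const, Procedure.expect_const_mul]
  linarith

variable (ps) in
/-- One sample from the query register. -/
def sampleProcedure : Procedure R Q Unit R where
  W := Unit
  init := ()
  size := 0
  card_eq := rfl
  steps := ps.map .query
  out b := b.1

theorem expect_sampleProcedure (F : R → ℝ) :
    (sampleProcedure ps).expect O r₀ () F = flagProb O ps r₀ F := by
  unfold Procedure.expect
  change ∑ b : R × Unit, _ = _
  rw [Fintype.sum_prod_type]
  refine Finset.sum_congr rfl fun r _ => ?_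
  rw [Fintype.sum_unique]
  have hs : slice (Equiv.refl (R × Unit)) () (EuclideanSpace.single (r₀, ()) 1) =
      EuclideanSpace.single r₀ 1 := by
    ext r
    simp [PiLp.single_apply]
  have h := slice_run_query O () ps (EuclideanSpace.single (r₀, ()) 1) ()
  rw [hs] at h
  exact congrArg (fun v : Ket R => ‖v r‖ ^ 2 * F r) h

variable (ps qs) in
/-- An estimate of the mean of `val`: a sample, corrected by an estimate of the mean deviation from
it. -/
def meanEstimate (val : R → ℝ) (D : ℝ) (t J : ℕ) : Procedure R Q Unit ℝ :=
  (sampleProcedure ps).bind (shiftEstimate ps qs r₀ size hsize val val D t J) r₀ (fun _ r => r)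
    (fun r w => val r + w) size hsize

theorem cost_meanEstimate (val : R → ℝ) (D : ℝ) (t J : ℕ) :
    cost (meanEstimate ps qs r₀ size hsize val D t J).steps =
      ps.length + 2 * (J * (ps.length + 2 ^ t * (ps.length + qs.length))) := by
  unfold meanEstimate shiftEstimate partEstimate
  rw [Procedure.cost_bind, Procedure.cost_bind,
    cost_sumProcedure _ _ _ _ _ fun l => cost_amplitudeEstimation r₀ _ t _,
    cost_sumProcedure _ _ _ _ _ fun l => cost_amplitudeEstimation r₀ _ t _]
  rw [sampleProcedure, cost_map_query]
  ring

/-- Here `q = 2 ^ K`, `k = K + 2` and `N = 2 ^ t`. The three terms are the truncation bias, at most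
`32/6400 = 0.005`, and the two error terms of amplitude estimation, which are both below `0.001`. -/
theorem numeric_failure_bound {D ε N k q : ℝ} (hD : 0 < D) (hε : 0 < ε) (hk : 2 ≤ k)
    (hq0 : 0 < q) (hq1 : 6400 * D ≤ q * ε) (hq2 : q * ε ≤ 12800 * D)
    (hN : 10000 * (k * D) ≤ N * ε) :
    4 / (q * D * ε) * (8 * D ^ 2) + 16 / ε ^ 2 * (4 * (k * (60 * (D ^ 2 + 2 * (8 * D ^ 2)) / N ^ 2 +
      30 * (q ^ 2 * D ^ 2) / N ^ 4))) ≤ 0.01 := by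
  have hN0 : 0 < N := by
    by_contra h
    have : N * ε ≤ 0 := mul_nonpos_of_nonpos_of_nonneg (not_lt.1 h) hε.le
    have : 0 < k * D := by positivity
    linarith
  have hA : D ^ 2 * k / (ε ^ 2 * N ^ 2) ≤ 1 / 10 ^ 8 := by
    rw [div_le_div_iff₀ (by positivity) (by norm_num)]
    have h1 : (10000 * (k * D)) ^ 2 ≤ (N * ε) ^ 2 := pow_le_pow_left₀ (by positivity) hN 2
    have h2 : k * D ^ 2 ≤ k * D ^ 2 * k := le_mul_of_one_le_right (by positivity) (by linarith)
    nlinarith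
  have hB : q ^ 2 * ε ^ 2 / D ^ 2 ≤ 12800 ^ 2 := by
    rw [div_le_iff₀ (by positivity), ← mul_pow, ← mul_pow]
    exact pow_le_pow_left₀ (by positivity) hq2 2
  have hC : D / (q * ε) ≤ 1 / 6400 := by
    rw [div_le_div_iff₀ (by positivity) (by norm_num)]
    linarith
  have hA0 : 0 ≤ D ^ 2 * k / (ε ^ 2 * N ^ 2) := by positivity
  have hB0 : 0 ≤ q ^ 2 * ε ^ 2 / D ^ 2 := by positivity
  have e : 4 / (q * D * ε) * (8 * D ^ 2) + 16 / ε ^ 2 * (4 * (k * (60 * (D ^ 2 + 2 * (8 * D ^ 2)) /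
      N ^ 2 + 30 * (q ^ 2 * D ^ 2) / N ^ 4))) = 32 * (D / (q * ε)) +
      65280 * (D ^ 2 * k / (ε ^ 2 * N ^ 2)) +
      1920 * ((q ^ 2 * ε ^ 2 / D ^ 2) * (D ^ 2 * k / (ε ^ 2 * N ^ 2)) ^ 2 / k) := by
    field_simp
    ring
  have hD1 : (q ^ 2 * ε ^ 2 / D ^ 2) * (D ^ 2 * k / (ε ^ 2 * N ^ 2)) ^ 2 / k ≤
      12800 ^ 2 * (1 / 10 ^ 8) ^ 2 / 2 := by gcongr
  rw [e]
  norm_num at hA hC hD1 ⊢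
  linarith

/-- Failure requires a truncation bias or an estimation error of at least `ε/4`. Both are handled by
Markov's inequality, averaged over the sample that serves as centre. -/
theorem le_expect_meanEstimate (hO : ∀ v, queryOp O qs (queryOp O ps v) = v) (val : R → ℝ)
    {D ε : ℝ} (hD : 0 < D) (hε : 0 < ε) (f₀ : ℝ)
    (hvar : (flagProb O ps r₀ fun r => (val r - f₀) ^ 2) ≤ 2 * D ^ 2) (t K : ℕ)
    (hK1 : 6400 * D ≤ 2 ^ K * ε) (hK2 : 2 ^ K * ε ≤ 12800 * D)
    (ht : 10000 * ((K + 2) * D) ≤ 2 ^ t * ε) {F : ℝ → ℝ} (hF0 : ∀ w, 0 ≤ F w)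
    (hF1 : ∀ w, |w - flagProb O ps r₀ val| ≤ ε / 2 → 1 ≤ F w) :
    0.99 ≤ (meanEstimate ps qs r₀ size hsize val D t (K + 1)).expect O r₀ () F := by
  set V : R → ℝ := fun r => flagProb O ps r₀ fun r' => (val r' - val r) ^ 2 with hV
  set s : R → ℝ := fun r => flagProb O ps r₀ fun r' =>
    trunc D (K + 1) (val r' - val r) - trunc D (K + 1) (-(val r' - val r)) with hs
  have hV0 : ∀ r, 0 ≤ V r := fun r => flagProb_nonneg r₀ fun r' => sq_nonneg _
  have hVE : flagProb O ps r₀ V ≤ 8 * D ^ 2 := by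
    have h1 : ∀ r, V r ≤ 4 * D ^ 2 + 2 * (val r - f₀) ^ 2 := by
      intro r
      calc V r ≤ flagProb O ps r₀ fun r' => 2 * (val r - f₀) ^ 2 + 2 * (val r' - f₀) ^ 2 :=
            flagProb_mono r₀ fun r' => by nlinarith [sq_nonneg ((val r' - f₀) + (val r - f₀))]
        _ = 2 * (val r - f₀) ^ 2 + 2 * flagProb O ps r₀ fun r' => (val r' - f₀) ^ 2 :=
            flagProb_add_mul r₀ _ _ _
        _ ≤ _ := by linarith
    calc flagProb O ps r₀ V ≤ flagProb O ps r₀ fun r => 4 * D ^ 2 + 2 * (val r - f₀) ^ 2 :=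
          flagProb_mono r₀ h1
      _ ≤ _ := by rw [flagProb_add_mul]; linarith
  have hbias : ∀ r, |val r + s r - flagProb O ps r₀ val| ≤ V r / (2 ^ K * D) := by
    intro r
    have e : flagProb O ps r₀ val = val r + flagProb O ps r₀ fun r' => val r' - val r := by
      have := flagProb_add_mul (O := O) (ps := ps) r₀ (-val r) 1 val
      rw [one_mul] at this
      rw [show (fun r' => val r' - val r) = fun r' => -val r + 1 * val r' by funext; ring, this]
      ring
    have e2 : val r + s r - flagProb O ps r₀ val = -∑ r',
        ‖queryOp O ps (EuclideanSpace.single r₀ 1) r'‖ ^ 2 * ((val r' - val r) -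
          (trunc D (K + 1) (val r' - val r) - trunc D (K + 1) (-(val r' - val r)))) := by
      rw [e]
      simp only [hs, flagProb, mul_sub, Finset.sum_sub_distrib]
      ring
    rw [e2, abs_neg]
    refine (Finset.abs_sum_le_sum_abs _ _).trans ?_
    rw [hV]
    simp only [flagProb]
    rw [Finset.sum_div]
    refine Finset.sum_le_sum fun r' _ => ?_
    rw [abs_mul, abs_of_nonneg (by positivity), mul_div_assoc]
    exact mul_le_mul_of_nonneg_left (abs_sub_trunc_le hD _ _) (by positivity)
  -- With these weights, `α V ≥ 1` when the bias bound reaches `ε/4`, and `β (w - s)² ≥ 1` when the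
  -- estimation error does.
  set α := 4 / (2 ^ K * D * ε) with hα
  set β := 16 / ε ^ 2 with hβ
  have hα0 : 0 < α := by positivity
  have hβ0 : 0 < β := by positivity
  have hpt : ∀ r w, (1 - α * V r) + -β * (w - s r) ^ 2 ≤ F (val r + w) := by
    intro r w
    by_cases hw : |val r + w - flagProb O ps r₀ val| ≤ ε / 2
    · have := hF1 _ hw
      have h1 := mul_nonneg hα0.le (hV0 r)
      have h2 := mul_nonneg hβ0.le (sq_nonneg (w - s r))
      linarith
    · refine le_trans ?_ (hF0 _)
      have h1 := mul_nonneg hα0.le (hV0 r)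
      have h2 := mul_nonneg hβ0.le (sq_nonneg (w - s r))
      have h3 : |val r + w - flagProb O ps r₀ val| ≤
          |val r + s r - flagProb O ps r₀ val| + |w - s r| := by
        rw [show val r + w - flagProb O ps r₀ val =
          (val r + s r - flagProb O ps r₀ val) + (w - s r) by ring]
        exact abs_add_le _ _
      by_cases h4 : ε / 4 ≤ |w - s r|
      · have : 1 ≤ β * (w - s r) ^ 2 := by
          rw [hβ, div_mul_eq_mul_div, le_div_iff₀ (by positivity), ← sq_abs (w - s r)]
          nlinarith
        linarith
      · have h5 : ε / 4 ≤ V r / (2 ^ K * D) := by linarith [hbias r]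
        have : 1 ≤ α * V r := by
          have e : α * V r = V r / (2 ^ K * D) * (4 / ε) := by rw [hα]; field_simp
          rw [e]
          calc (1 : ℝ) = ε / 4 * (4 / ε) := by field_simp
            _ ≤ _ := mul_le_mul_of_nonneg_right h5 (by positivity)
        linarith
  rw [meanEstimate, Procedure.expect_bind, expect_sampleProcedure]
  set N : ℝ := 2 ^ t with hN
  -- The error bound is affine in `V r`: `A` is its value at `V r = 0` and `B` its slope, so
  -- averaging over `r` needs only the mean of `V`.
  set A : ℝ := 4 * ((K + 2) * (60 * (D ^ 2 + 2 * 0) / N ^ 2 + 30 * (4 ^ K * D ^ 2) / N ^ 4)) with hA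
  set B : ℝ := 4 * ((K + 2) * (120 / N ^ 2)) with hB
  have hB0 : 0 ≤ B := by positivity
  have hin : ∀ r, (1 - β * A) + -(α + β * B) * V r ≤
      (shiftEstimate ps qs r₀ size hsize val val D t (K + 1)).expect O r₀ r
        fun w => F (val r + w) := by
    intro r
    refine le_trans ?_ (Procedure.expect_mono O r₀ r _ (hpt r))
    rw [Procedure.expect_add, Procedure.expect_const, Procedure.expect_const_mul]
    have h1 := mul_le_mul_of_nonneg_left
      (expect_shiftEstimate_le (C := R) r₀ size hsize hO val val hD t K r) hβ0.le
    have h2 : 4 * (((K : ℝ) + 2) * (60 * (D ^ 2 + 2 * V r) / N ^ 2 +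
        30 * (4 ^ K * D ^ 2) / N ^ 4)) = A + B * V r := by
      rw [hA, hB]
      ring
    rw [← hN] at h1
    change _ ≤ β * (4 * (((K : ℝ) + 2) * (60 * (D ^ 2 + 2 * V r) / N ^ 2 +
        30 * (4 ^ K * D ^ 2) / N ^ 4))) at h1
    rw [h2] at h1
    linarith
  refine le_trans ?_ (flagProb_mono r₀ hin)
  rw [flagProb_add_mul]
  have hnum := numeric_failure_bound (D := D) (ε := ε) (N := N) (k := K + 2) (q := 2 ^ K) hD hε
    (by linarith [show (0 : ℝ) ≤ K from K.cast_nonneg]) (by positivity) hK1 hK2 ht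
  have e4 : ((2 : ℝ) ^ K) ^ 2 = 4 ^ K := by
    rw [← pow_mul, mul_comm K 2, pow_mul]
    norm_num
  rw [e4] at hnum
  have h6 : α * (8 * D ^ 2) + β * (A + B * (8 * D ^ 2)) ≤ 0.01 := by
    refine le_trans (le_of_eq ?_) hnum
    rw [hA, hB]
    ring
  have h7 := mul_le_mul_of_nonneg_left hVE (show 0 ≤ α + β * B by positivity)
  norm_num at h6 ⊢
  linarith

end Mean

/-! ### Translation into query algorithms -/

section Unitary

variable {I : Type*} [Fintype I] [DecidableEq I]

/-- The isometry given by a unitary matrix. -/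
def isoOfUnitary (M : Matrix.unitaryGroup I ℂ) : Ket I ≃ₗᵢ[ℂ] Ket I :=
  Unitary.linearIsometryEquiv
    ⟨Matrix.toEuclideanCLM (𝕜 := ℂ) (n := I) M, Unitary.map_mem _ M.2⟩

/-- The unitary matrix of an isometry. -/
def unitaryOfIso (V : Ket I ≃ₗᵢ[ℂ] Ket I) : Matrix.unitaryGroup I ℂ :=
  ⟨(Matrix.toEuclideanCLM (𝕜 := ℂ) (n := I)).symm (Unitary.linearIsometryEquiv.symm V : _ →L[ℂ] _),
    by
      rw [Matrix.mem_unitaryGroup_iff]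
      apply EquivLike.injective (Matrix.toEuclideanCLM (𝕜 := ℂ) (n := I))
      rw [map_mul, map_star, StarAlgEquiv.apply_symm_apply, map_one]
      exact (Unitary.mem_iff.1 (Unitary.linearIsometryEquiv.symm V).2).2⟩

theorem isoOfUnitary_apply (M : Matrix.unitaryGroup I ℂ) (v : Ket I) :
    (isoOfUnitary M v : I → ℂ) = (M : Matrix I I ℂ) *ᵥ v := rfl

theorem isoOfUnitary_symm_apply (M : Matrix.unitaryGroup I ℂ) (v : Ket I) :
    ((isoOfUnitary M).symm v : I → ℂ) = (M : Matrix I I ℂ)ᴴ *ᵥ v := by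
  have : (isoOfUnitary M).symm v = isoOfUnitary (star M) v := by
    rw [LinearIsometryEquiv.symm_apply_eq]
    ext1
    rw [isoOfUnitary_apply, isoOfUnitary_apply, Matrix.mulVec_mulVec, ← Matrix.UnitaryGroup.mul_val]
    simp
  rw [this]
  rfl

theorem unitaryOfIso_mulVec (V : Ket I ≃ₗᵢ[ℂ] Ket I) (v : Ket I) :
    (unitaryOfIso V : Matrix I I ℂ) *ᵥ v = (V v : I → ℂ) := by
  have : Matrix.toEuclideanCLM (𝕜 := ℂ) (n := I) (unitaryOfIso V) = (V : Ket I →L[ℂ] Ket I) :=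
    (Matrix.toEuclideanCLM (𝕜 := ℂ) (n := I)).apply_symm_apply _
  rw [← Matrix.ofLp_toEuclideanCLM, this]
  rfl

end Unitary

/-- The queries: to the network, to the loader, and to the inverse of the loader. -/
inductive Access : Type
  | nn : Access
  | load : Access
  | loadInv : Access

section Translation

variable {n c₁ c₂ : ℕ}

/-- The permutation of the basis underlying `accessUnitary g`. -/
def accessPerm (g : Bits n → FixedPoint c₁ c₂) : Equiv.Perm (Bits n × FixedPoint c₁ c₂) where
  toFun b := (b.1, FixedPoint.xor b.2 (g b.1))
  invFun b := (b.1, FixedPoint.xor b.2 (g b.1))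
  left_inv b := by simp [FixedPoint.xor_xor_cancel]
  right_inv b := by simp [FixedPoint.xor_xor_cancel]

/-- The queried isometries. -/
def oracle (g : Bits n → FixedPoint c₁ c₂) (U : Matrix.unitaryGroup (Bits n) ℂ) :
    Access → Ket (Bits n × FixedPoint c₁ c₂) ≃ₗᵢ[ℂ] Ket (Bits n × FixedPoint c₁ c₂)
  | .nn => LinearIsometryEquiv.piLpCongrLeft 2 ℂ ℂ (accessPerm g)
  | .load => actOn (Equiv.refl _) fun _ => isoOfUnitary U
  | .loadInv => actOn (Equiv.refl _) fun _ => (isoOfUnitary U).symm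

theorem oracle_nn_apply (g : Bits n → FixedPoint c₁ c₂) (U : Matrix.unitaryGroup (Bits n) ℂ)
    (v : Ket (Bits n × FixedPoint c₁ c₂)) (x : Bits n) (y : FixedPoint c₁ c₂) :
    oracle g U .nn v (x, y) = v (x, FixedPoint.xor y (g x)) := rfl

theorem accessUnitary_mulVec (g : Bits n → FixedPoint c₁ c₂)
    (v : Bits n × FixedPoint c₁ c₂ → ℂ) (x : Bits n) (y : FixedPoint c₁ c₂) :
    (accessUnitary g *ᵥ v) (x, y) = v (x, FixedPoint.xor y (g x)) := by
  have : ∀ j : Bits n × FixedPoint c₁ c₂, (x, y) = (j.1, FixedPoint.xor j.2 (g j.1)) ↔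
      j = (x, FixedPoint.xor y (g x)) := fun j => by
    rw [eq_comm]
    exact ((accessPerm g).eq_symm_apply (x := (x, y)) (y := j)).symm
  simp [accessUnitary, Matrix.mulVec, dotProduct, this]

/-- The gate corresponding to a step. -/
def Step.toGate {W : Type} [Fintype W] {a : ℕ} (e : W ≃ Bits a) :
    Step (Bits n × FixedPoint c₁ c₂) Access Unit W → Gate n c₁ c₂ a
  | .free V => .free (unitaryOfIso
      ((LinearIsometryEquiv.piLpCongrLeft 2 ℂ ℂ ((Equiv.refl _).prodCongr e)).symm.trans
        ((V ()).trans (LinearIsometryEquiv.piLpCongrLeft 2 ℂ ℂ ((Equiv.refl _).prodCongr e)))))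
  | .query .nn => .nn
  | .query .load => .load
  | .query .loadInv => .loadInv

theorem toGate_mulVec {W : Type} [Fintype W] {a : ℕ} (e : W ≃ Bits a)
    (g : Bits n → FixedPoint c₁ c₂) (U : Matrix.unitaryGroup (Bits n) ℂ)
    (s : Step (Bits n × FixedPoint c₁ c₂) Access Unit W) (Ψ : Ket ((Bits n × FixedPoint c₁ c₂) × W)) :
    (s.toGate e).matrix g U *ᵥ (fun b => Ψ (b.1, e.symm b.2)) =
      fun b => s.op (oracle g U) () Ψ (b.1, e.symm b.2) := by
  cases s with
  | free V =>
    have := unitaryOfIso_mulVec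
      ((LinearIsometryEquiv.piLpCongrLeft 2 ℂ ℂ ((Equiv.refl _).prodCongr e)).symm.trans
        ((V ()).trans (LinearIsometryEquiv.piLpCongrLeft 2 ℂ ℂ ((Equiv.refl _).prodCongr e))))
      (LinearIsometryEquiv.piLpCongrLeft 2 ℂ ℂ
        ((Equiv.refl (Bits n × FixedPoint c₁ c₂)).prodCongr e) Ψ)
    simp only [LinearIsometryEquiv.trans_apply, LinearIsometryEquiv.symm_apply_apply] at this
    exact this
  | query q =>
    cases q with
    | nn =>
      ext ⟨⟨x, y⟩, s⟩
      have h : (accessUnitary g ⊗ₖ (1 : Matrix (Bits a) (Bits a) ℂ) *ᵥ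
          fun b => Ψ (b.1, e.symm b.2)) ((x, y), s) =
          (accessUnitary g *ᵥ fun r => Ψ (r, e.symm s)) (x, y) := by
        simp [Matrix.mulVec, dotProduct, Fintype.sum_prod_type, Matrix.kroneckerMap_apply,
          Matrix.one_apply]
      exact h.trans (accessUnitary_mulVec g _ x y)
    | load =>
      ext ⟨⟨x, y⟩, s⟩
      have h : (((U : Matrix (Bits n) (Bits n) ℂ) ⊗ₖ
          (1 : Matrix (FixedPoint c₁ c₂) (FixedPoint c₁ c₂) ℂ)) ⊗ₖ
          (1 : Matrix (Bits a) (Bits a) ℂ) *ᵥ fun b => Ψ (b.1, e.symm b.2)) ((x, y), s) =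
          ((U : Matrix (Bits n) (Bits n) ℂ) *ᵥ fun x => Ψ ((x, y), e.symm s)) x := by
        simp only [Matrix.mulVec, dotProduct, Matrix.kroneckerMap_apply, Matrix.one_apply]
        rw [Fintype.sum_prod_type, Fintype.sum_prod_type]
        simp
      exact h.trans (congrFun (isoOfUnitary_apply U
        (WithLp.toLp 2 fun x => Ψ ((x, y), e.symm s))) x).symm
    | loadInv =>
      ext ⟨⟨x, y⟩, s⟩
      have h : (((U : Matrix (Bits n) (Bits n) ℂ)ᴴ ⊗ₖ
          (1 : Matrix (FixedPoint c₁ c₂) (FixedPoint c₁ c₂) ℂ)) ⊗ₖ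
          (1 : Matrix (Bits a) (Bits a) ℂ) *ᵥ fun b => Ψ (b.1, e.symm b.2)) ((x, y), s) =
          ((U : Matrix (Bits n) (Bits n) ℂ)ᴴ *ᵥ fun x => Ψ ((x, y), e.symm s)) x := by
        simp only [Matrix.mulVec, dotProduct, Matrix.kroneckerMap_apply, Matrix.one_apply]
        rw [Fintype.sum_prod_type, Fintype.sum_prod_type]
        simp
      exact h.trans (congrFun (isoOfUnitary_symm_apply U
        (WithLp.toLp 2 fun x => Ψ ((x, y), e.symm s))) x).symm

theorem foldl_toGate {W : Type} [Fintype W] {a : ℕ} (e : W ≃ Bits a)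
    (g : Bits n → FixedPoint c₁ c₂) (U : Matrix.unitaryGroup (Bits n) ℂ)
    (l : List (Step (Bits n × FixedPoint c₁ c₂) Access Unit W))
    (Ψ : Ket ((Bits n × FixedPoint c₁ c₂) × W)) :
    (l.map (Step.toGate e)).foldl (fun ψ G => G.matrix g U *ᵥ ψ) (fun b => Ψ (b.1, e.symm b.2)) =
      fun b => run (oracle g U) () l Ψ (b.1, e.symm b.2) := by
  induction l generalizing Ψ with
  | nil => rfl
  | cons s l ih => rw [List.map_cons, List.foldl_cons, toGate_mulVec, ih, run_cons]

theorem exists_encoding {W : Type} [Fintype W] [DecidableEq W] (w : W) {a : ℕ}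
    (h : Fintype.card W = 2 ^ a) : ∃ e : W ≃ Bits a, e w = Bits.zero a := by
  obtain ⟨e⟩ : Nonempty (W ≃ Bits a) := Fintype.card_eq.1 (by simp [h])
  -- A transposition of labels moves the initial ancilla state to the all-zero string.
  exact ⟨e.trans (Equiv.swap (e w) (Bits.zero a)), by simp⟩

/-- A procedure without control is a query algorithm with the same outcome distribution. -/
theorem exists_queryAlgorithm (P : Procedure (Bits n × FixedPoint c₁ c₂) Access Unit ℝ) :
    ∃ A : QueryAlgorithm n c₁ c₂, A.nnQueries ≤ cost P.steps ∧ A.loadQueries ≤ cost P.steps ∧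
      ∀ g U S, A.outputProb g U S = P.expect (oracle g U)
        (Bits.zero n, FixedPoint.zero c₁ c₂) () (S.indicator fun _ => 1) := by
  obtain ⟨e, he⟩ := exists_encoding P.init P.card_eq
  refine ⟨⟨P.size, P.steps.map (Step.toGate e), fun b => P.out (b.1, e.symm b.2)⟩, ?_, ?_, ?_⟩
  · unfold QueryAlgorithm.nnQueries cost
    rw [List.map_map]
    refine List.sum_le_sum fun s _ => ?_
    rcases s with V | q
    · exact le_rfl
    · cases q <;> simp [Step.toGate, Gate.nnCost, Step.cost]
  · unfold QueryAlgorithm.loadQueries cost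
    rw [List.map_map]
    refine List.sum_le_sum fun s _ => ?_
    rcases s with V | q
    · exact le_rfl
    · cases q <;> simp [Step.toGate, Gate.loadCost, Step.cost]
  · intro g U S
    let : DecidableEq ((Bits n × FixedPoint c₁ c₂) × P.W) := instDecidableEqProd
    have h0 : (Pi.single ((Bits.zero n, FixedPoint.zero c₁ c₂), Bits.zero P.size) 1 :
        Basis n c₁ c₂ P.size → ℂ) = fun b => (EuclideanSpace.single
          ((Bits.zero n, FixedPoint.zero c₁ c₂), P.init) (1 : ℂ)) (b.1, e.symm b.2) := by
      ext ⟨r, s⟩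
      rw [PiLp.single_apply, Pi.single_apply]
      have : (r, s) = ((Bits.zero n, FixedPoint.zero c₁ c₂), Bits.zero P.size) ↔
          (r, e.symm s) = ((Bits.zero n, FixedPoint.zero c₁ c₂), P.init) := by
        refine Prod.mk_inj.trans (Iff.trans ?_ Prod.mk_inj.symm)
        rw [← he, Equiv.symm_apply_eq]
      simp only [this]
    have h1 : ∀ b, QueryAlgorithm.finalState
        ⟨P.size, P.steps.map (Step.toGate e), fun b => P.out (b.1, e.symm b.2)⟩ g U b =
          P.final (oracle g U) (Bits.zero n, FixedPoint.zero c₁ c₂) () (b.1, e.symm b.2) := by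
      intro b
      unfold QueryAlgorithm.finalState Procedure.final
      simp only
      rw [h0]
      exact congrFun (foldl_toGate e g U P.steps _) b
    unfold QueryAlgorithm.outputProb Procedure.expect
    rw [← ((Equiv.refl (Bits n × FixedPoint c₁ c₂)).prodCongr e).symm.sum_comp]
    refine Finset.sum_congr rfl fun b _ => ?_
    have h2 : ((Equiv.refl (Bits n × FixedPoint c₁ c₂)).prodCongr e).symm b = (b.1, e.symm b.2) :=
      rfl
    rw [h2]
    by_cases hS : P.out (b.1, e.symm b.2) ∈ S
    · rw [Set.indicator_of_mem (by exact hS), Set.indicator_of_mem hS, h1, mul_one]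
    · rw [Set.indicator_of_notMem (by exact hS), Set.indicator_of_notMem hS, mul_zero]

theorem FixedPoint.xor_eq_zero_iff (y z : FixedPoint c₁ c₂) :
    FixedPoint.xor y z = FixedPoint.zero c₁ c₂ ↔ y = z := by
  constructor
  · intro h
    rw [← FixedPoint.xor_xor_cancel y z, h]
    simp [FixedPoint.xor, FixedPoint.zero, Bits.zero]
  · rintro rfl
    simp [FixedPoint.xor, FixedPoint.zero, Bits.zero, funext_iff]

theorem queryOp_oracle_cancel (g : Bits n → FixedPoint c₁ c₂) (U : Matrix.unitaryGroup (Bits n) ℂ)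
    (v : Ket (Bits n × FixedPoint c₁ c₂)) :
    queryOp (oracle g U) [.nn, .loadInv] (queryOp (oracle g U) [.load, .nn] v) = v := by
  have h : ∀ v, oracle g U .nn (oracle g U .nn v) = v := by
    intro v
    ext ⟨x, y⟩
    rw [oracle_nn_apply, oracle_nn_apply, FixedPoint.xor_xor_cancel]
  change oracle g U .loadInv (oracle g U .nn (oracle g U .nn (oracle g U .load v))) = v
  rw [h]
  exact (oracle g U .load).symm_apply_apply v

/-- Loading and then querying the network prepares `∑ √(p x) |x, g x⟩`, because the output register
starts at zero; its basis measurement is a classical sample together with its computed value. -/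
theorem flagProb_oracle (g : Bits n → FixedPoint c₁ c₂) (U : Matrix.unitaryGroup (Bits n) ℂ)
    {p : Bits n → ℝ} (hp : ∀ x, 0 ≤ p x) (hU : IsLoader U p)
    (φ : Bits n × FixedPoint c₁ c₂ → ℝ) :
    flagProb (oracle g U) [.load, .nn] (Bits.zero n, FixedPoint.zero c₁ c₂) φ =
      ∑ x, p x * φ (x, g x) := by
  have h : ∀ x y, queryOp (oracle g U) [.load, .nn]
      (EuclideanSpace.single (Bits.zero n, FixedPoint.zero c₁ c₂) 1) (x, y) =
        if y = g x then ((√(p x) : ℝ) : ℂ) else 0 := by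
    intro x y
    change oracle g U .nn (oracle g U .load _) (x, y) = _
    rw [oracle_nn_apply]
    have hs : slice (Equiv.refl (Bits n × FixedPoint c₁ c₂)) (FixedPoint.xor y (g x))
        (EuclideanSpace.single (Bits.zero n, FixedPoint.zero c₁ c₂) 1) =
        (if y = g x then (1 : ℂ) else 0) • EuclideanSpace.single (Bits.zero n) 1 := by
      ext x'
      simp only [slice_apply, Equiv.refl_symm, Equiv.refl_apply, PiLp.single_apply, Prod.mk_inj,
        FixedPoint.xor_eq_zero_iff, PiLp.smul_apply, smul_eq_mul]
      split_ifs <;> simp_all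
    change isoOfUnitary U (slice (Equiv.refl (Bits n × FixedPoint c₁ c₂)) (FixedPoint.xor y (g x))
        (EuclideanSpace.single (Bits.zero n, FixedPoint.zero c₁ c₂) 1)) x = _
    rw [hs, map_smul, PiLp.smul_apply, congrFun (isoOfUnitary_apply U _) x]
    have := congrFun hU x
    rw [PiLp.ofLp_single, this]
    simp
  unfold flagProb
  rw [Fintype.sum_prod_type]
  refine Finset.sum_congr rfl fun x _ => ?_
  rw [Finset.sum_eq_single (g x)]
  · rw [h, if_pos rfl, Complex.norm_real, Real.norm_eq_abs, sq_abs, Real.sq_sqrt (hp x)]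
  · intro y _ hy
    rw [h, if_neg hy]
    simp
  · simp

end Translation

/-! ### Classical sampling -/

/-- Variances of independent centred variables add. The shift `c` absorbs the first coordinate in
the induction on `k`. -/
theorem sum_prod_mul_sq_add_sum {α : Type*} [Fintype α] (p h : α → ℝ)
    (hp : ∑ x, p x = 1) (hh : ∑ x, p x * h x = 0) (k : ℕ) (c : ℝ) :
    ∑ x : Fin k → α, (∏ i, p (x i)) * (c + ∑ i, h (x i)) ^ 2 =
      c ^ 2 + k * ∑ x, p x * h x ^ 2 := by
  induction k generalizing c with
  | zero => simp
  | succ k ih =>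
    rw [← (Fin.consEquiv fun _ => α).sum_comp, Fintype.sum_prod_type]
    simp only [Fin.consEquiv_apply, Fin.prod_univ_succ, Fin.sum_univ_succ, Fin.cons_zero,
      Fin.cons_succ]
    have : ∀ a, ∑ x : Fin k → α, p a * (∏ i, p (x i)) * (c + (h a + ∑ i, h (x i))) ^ 2 =
        p a * c ^ 2 + 2 * c * (p a * h a) + p a * h a ^ 2 + p a * (k * ∑ x, p x * h x ^ 2) := by
      intro a
      simp_rw [← add_assoc, mul_assoc, ← Finset.mul_sum]
      rw [ih]
      ring
    simp_rw [this, Finset.sum_add_distrib, ← Finset.mul_sum, ← Finset.sum_mul, hp, hh]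
    push_cast
    ring

theorem sum_prod_eq_one {α : Type*} [Fintype α] (p : α → ℝ) (hp : ∑ x, p x = 1) (k : ℕ) :
    ∑ x : Fin k → α, ∏ i, p (x i) = 1 := by
  have := sum_prod_mul_sq_add_sum p (fun _ => 0) hp (by simp) k 1
  simpa using this

/-- Chebyshev's inequality, through a pointwise lower bound for the indicator of `S`. -/
theorem Network.le_classicalProb {n c₁ c₂ : ℕ} (N : Network n c₁ c₂) {k : ℕ} (hk : 0 < k)
    {σ δ μ : ℝ} (hδ : 0 < δ) (hμ : ∑ x, N.p x * (N.code x).value = μ)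
    (hσ : ∑ x, N.p x * ((N.code x).value - μ) ^ 2 ≤ σ) {S : Set ℝ}
    (hS : ∀ w, |w - μ| ≤ δ → w ∈ S) : 1 - σ / (k * δ ^ 2) ≤ N.classicalProb k S := by
  have hp0 : ∀ x, 0 ≤ N.p x := N.p_mem.1
  have hp1 : ∑ x, N.p x = 1 := N.p_mem.2
  have hk' : (0 : ℝ) < k := by exact_mod_cast hk
  have hh : ∑ x, N.p x * ((N.code x).value - μ) = 0 := by
    simp_rw [mul_sub, Finset.sum_sub_distrib, ← Finset.sum_mul, hp1, hμ]
    ring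
  have h2 := sum_prod_mul_sq_add_sum N.p (fun x => (N.code x).value - μ) hp1 hh k 0
  have h1 := sum_prod_eq_one N.p hp1 k
  have key : ∀ x : Fin k → Bits n, (∏ i, N.p (x i)) -
      1 / (k ^ 2 * δ ^ 2) * ((∏ i, N.p (x i)) * (0 + ∑ i, ((N.code (x i)).value - μ)) ^ 2) ≤
      {x : Fin k → Bits n | (∑ i, (N.code (x i)).value) / k ∈ S}.indicator
        (fun x => ∏ i, N.p (x i)) x := by
    intro x
    have hP : 0 ≤ ∏ i, N.p (x i) := Finset.prod_nonneg fun i _ => hp0 _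
    by_cases hx : (∑ i, (N.code (x i)).value) / k ∈ S
    · rw [Set.indicator_of_mem (by exact hx)]
      have : 0 ≤ 1 / (k ^ 2 * δ ^ 2) *
          ((∏ i, N.p (x i)) * (0 + ∑ i, ((N.code (x i)).value - μ)) ^ 2) := by positivity
      linarith
    · rw [Set.indicator_of_notMem (by exact hx)]
      have h3 : δ ≤ |(∑ i, (N.code (x i)).value) / k - μ| := by
        by_contra h
        exact hx (hS _ (not_le.1 h).le)
      have h4 : (0 + ∑ i, ((N.code (x i)).value - μ)) = k * ((∑ i, (N.code (x i)).value) / k - μ) := by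
        rw [Finset.sum_sub_distrib]
        simp
        field_simp
      have h5 : 1 ≤ 1 / (k ^ 2 * δ ^ 2) * (0 + ∑ i, ((N.code (x i)).value - μ)) ^ 2 := by
        rw [h4, mul_pow, one_div_mul_eq_div, le_div_iff₀ (by positivity), one_mul]
        refine mul_le_mul_of_nonneg_left ?_ (by positivity)
        rw [← sq_abs ((∑ i, (N.code (x i)).value) / k - μ)]
        exact pow_le_pow_left₀ hδ.le h3 2
      have := mul_le_mul_of_nonneg_left h5 hP
      linarith
  refine le_trans ?_ (Finset.sum_le_sum fun x _ => key x)
  rw [Finset.sum_sub_distrib, ← Finset.mul_sum, h1, h2]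
  have e : 1 / ((k : ℝ) ^ 2 * δ ^ 2) * (0 ^ 2 + k * ∑ x, N.p x * ((N.code x).value - μ) ^ 2) =
      (∑ x, N.p x * ((N.code x).value - μ) ^ 2) / (k * δ ^ 2) := by
    field_simp
    ring
  rw [e]
  gcongr

/-! ### The estimation problem -/

section Moments

variable {n c₁ c₂ r : ℕ} {L B M ε Λ : ℝ}

/-- The computed values deviate from `f 0` by `O(Λ + ε)` in mean square. -/
theorem Network.sum_sq_sub_le (N : Network n c₁ c₂) (hL : 0 ≤ L) (hM : 0 ≤ M)
    (hε : 0 < ε) (hΛ : Λ = (L + B ^ 2) * (1 + M)) (hr : r = 1 ∨ (r = 2 ∧ 1 ≤ Λ))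
    (hlip : N.IsLip r L) (hsec : N.secondMoment ≤ M) (hcode : N.IsComputedWithin (ε / 2)) :
    ∑ x, N.p x * ((N.code x).value - N.f 0) ^ 2 ≤ 2 * (Λ + ε) ^ 2 := by
  have hp0 : ∀ x, 0 ≤ N.p x := N.p_mem.1
  have hp1 : ∑ x, N.p x = 1 := N.p_mem.2
  have hΛL : L * (1 + M) ≤ Λ := by
    rw [hΛ]
    nlinarith [mul_nonneg (sq_nonneg B) (show 0 ≤ 1 + M by linarith)]
  have hΛ0 : 0 ≤ Λ := (by positivity : 0 ≤ L * (1 + M)).trans hΛL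
  -- The two Lipschitz conditions are unified by `G = L²` for `r = 1` and `G = L` for `r = 2`; in
  -- the second case `L M ≤ Λ ≤ Λ²` uses `1 ≤ Λ`.
  obtain ⟨G, hG0, hG, hGM⟩ : ∃ G : ℝ, 0 ≤ G ∧
      (∀ x, (N.f (N.point x) - N.f 0) ^ 2 ≤ G * ‖N.point x‖ ^ 2) ∧ G * M ≤ Λ ^ 2 := by
    rcases hr with rfl | ⟨rfl, h1⟩
    · refine ⟨L ^ 2, by positivity, fun x => ?_, ?_⟩
      · have := hlip (N.point x) 0
        rw [pow_one, pow_one, sub_zero] at this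
        rw [← sq_abs, ← mul_pow]
        exact pow_le_pow_left₀ (abs_nonneg _) this 2
      · calc L ^ 2 * M ≤ (L * (1 + M)) ^ 2 := by
              rw [mul_pow]
              exact mul_le_mul_of_nonneg_left (by nlinarith) (by positivity)
          _ ≤ Λ ^ 2 := pow_le_pow_left₀ (by positivity) hΛL 2
    · refine ⟨L, hL, fun x => ?_, by nlinarith⟩
      have := hlip (N.point x) 0
      rwa [sub_zero, sq_abs] at this
  have hpt : ∀ x, N.p x * ((N.code x).value - N.f 0) ^ 2 ≤
      2 * G * (N.p x * ‖N.point x‖ ^ 2) + N.p x * (ε ^ 2 / 2) := by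
    intro x
    rcases (hp0 x).eq_or_lt with h | h
    · simp [← h]
    · have h1 : ((N.code x).value - N.f (N.point x)) ^ 2 ≤ (ε / 2) ^ 2 := by
        rw [← sq_abs]
        exact pow_le_pow_left₀ (abs_nonneg _) (hcode x h) 2
      have h2 : ((N.code x).value - N.f 0) ^ 2 ≤ 2 * G * ‖N.point x‖ ^ 2 + ε ^ 2 / 2 := by
        nlinarith [hG x, sq_nonneg (((N.code x).value - N.f (N.point x)) -
          (N.f (N.point x) - N.f 0))]
      have := mul_le_mul_of_nonneg_left h2 h.le
      linarith
  calc _ ≤ ∑ x, (2 * G * (N.p x * ‖N.point x‖ ^ 2) + N.p x * (ε ^ 2 / 2)) :=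
        Finset.sum_le_sum fun x _ => hpt x
    _ = 2 * G * N.secondMoment + ε ^ 2 / 2 := by
        rw [Finset.sum_add_distrib, ← Finset.mul_sum, ← Finset.sum_mul, hp1, one_mul]
        rfl
    _ ≤ 2 * G * M + ε ^ 2 / 2 := by gcongr
    _ ≤ _ := by nlinarith [mul_nonneg hΛ0 hε.le, sq_nonneg ε]

theorem Network.abs_sum_sub_mean_le (N : Network n c₁ c₂) {η : ℝ} (hcode : N.IsComputedWithin η) :
    |∑ x, N.p x * (N.code x).value - N.mean| ≤ η := by
  have hp0 : ∀ x, 0 ≤ N.p x := N.p_mem.1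
  have hp1 : ∑ x, N.p x = 1 := N.p_mem.2
  unfold Network.mean
  rw [← Finset.sum_sub_distrib]
  refine (Finset.abs_sum_le_sum_abs _ _).trans ?_
  calc _ ≤ ∑ x, N.p x * η := Finset.sum_le_sum fun x _ => by
        rw [← mul_sub, abs_mul, abs_of_nonneg (hp0 x)]
        rcases (hp0 x).eq_or_lt with h | h
        · simp [← h]
        · exact mul_le_mul_of_nonneg_left (hcode x h) h.le
    _ = η := by rw [← Finset.sum_mul, hp1, one_mul]

theorem Network.abs_sub_mean_le (N : Network n c₁ c₂) (hcode : N.IsComputedWithin (ε / 2)) {w : ℝ}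
    (hw : |w - ∑ x, N.p x * (N.code x).value| ≤ ε / 2) : |w - N.mean| ≤ ε := by
  rw [show w - N.mean = (w - ∑ x, N.p x * (N.code x).value) +
    (∑ x, N.p x * (N.code x).value - N.mean) by ring]
  exact (abs_add_le _ _).trans (by linarith [N.abs_sum_sub_mean_le hcode])

theorem classical_guarantee (N : Network n c₁ c₂) (k : ℕ) (hL : 0 ≤ L) (hM : 0 ≤ M)
    (hε : 0 < ε) (hΛ : Λ = (L + B ^ 2) * (1 + M)) (hr : r = 1 ∨ (r = 2 ∧ 1 ≤ Λ))
    (hlip : N.IsLip r L) (hsec : N.secondMoment ≤ M) (hcode : N.IsComputedWithin (ε / 2))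
    (hk : 10 ^ 8 * (1 + Λ / ε) ^ 2 ≤ (k : ℝ)) :
    0.99 ≤ N.classicalProb k {w : ℝ | |w - N.mean| ≤ ε} := by
  have hp1 : ∑ x, N.p x = 1 := N.p_mem.2
  have hΛ0 : 0 ≤ Λ := by rw [hΛ]; positivity
  have hk0 : (0 : ℝ) < k := lt_of_lt_of_le (by positivity) hk
  set μ := ∑ x, N.p x * (N.code x).value with hμ
  -- The second moment about the mean does not exceed the one about `f 0`.
  have hvar : ∑ x, N.p x * ((N.code x).value - μ) ^ 2 ≤ 2 * (Λ + ε) ^ 2 := by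
    refine le_trans ?_ (N.sum_sq_sub_le hL hM hε hΛ hr hlip hsec hcode)
    have e : ∑ x, N.p x * ((N.code x).value - N.f 0) ^ 2 =
        ∑ x, N.p x * ((N.code x).value - μ) ^ 2 + (μ - N.f 0) ^ 2 := by
      have : ∀ x, N.p x * ((N.code x).value - N.f 0) ^ 2 =
          N.p x * ((N.code x).value - μ) ^ 2 +
            (2 * (μ - N.f 0) * (N.p x * (N.code x).value) -
              N.p x * (2 * (μ - N.f 0) * μ - (μ - N.f 0) ^ 2)) := fun x => by ring
      rw [Finset.sum_congr rfl fun x _ => this x, Finset.sum_add_distrib, Finset.sum_sub_distrib,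
        ← Finset.mul_sum, ← Finset.sum_mul, hp1, ← hμ]
      ring
    rw [e]
    exact le_add_of_nonneg_right (sq_nonneg _)
  refine le_trans ?_ (N.le_classicalProb (by exact_mod_cast hk0) (half_pos hε) rfl hvar
    fun w hw => N.abs_sub_mean_le hcode hw)
  have h1 : 2 * (Λ + ε) ^ 2 / (k * (ε / 2) ^ 2) ≤ 8 / 10 ^ 8 := by
    have e : (1 + Λ / ε) ^ 2 * ε ^ 2 = (Λ + ε) ^ 2 := by field_simp; ring
    rw [div_le_div_iff₀ (by positivity) (by positivity)]
    nlinarith [mul_le_mul_of_nonneg_right hk (sq_nonneg ε)]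
  norm_num at h1 ⊢
  linarith

end Moments

/-! ### Choice of parameters and query count -/

theorem exists_pow_two_mem {x : ℝ} (hx : 1 ≤ x) : ∃ K : ℕ, x ≤ 2 ^ K ∧ (2 : ℝ) ^ K ≤ 2 * x := by
  obtain ⟨k, h1, h2⟩ := exists_nat_pow_near hx (one_lt_two (α := ℝ))
  exact ⟨k + 1, h2.le, by rw [pow_succ]; linarith⟩

/-- From `12800 ≤ 2^14` and `1/log 2 < 2` one gets `K ≤ 14 + 2 log x`. -/
theorem levels_le {x : ℝ} (hx : 1 ≤ x) {K : ℕ} (hK : (2 : ℝ) ^ K ≤ 12800 * x) :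
    (K : ℝ) + 2 ≤ 16 * (1 + Real.log x) := by
  have hl : 0 ≤ Real.log x := Real.log_nonneg hx
  have h1 : K * Real.log 2 ≤ Real.log 12800 + Real.log x := by
    rw [← Real.log_pow, ← Real.log_mul (by norm_num) (by linarith)]
    exact Real.log_le_log (by positivity) hK
  have h2 : Real.log 12800 ≤ 14 * Real.log 2 := by
    have : Real.log 12800 ≤ Real.log (2 ^ 14) := Real.log_le_log (by norm_num) (by norm_num)
    rwa [Real.log_pow] at this
  have h3 := Real.log_two_gt_d9
  have h4 : (K : ℝ) ≤ 14 + 2 * Real.log x := by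
    by_contra h
    have := mul_lt_mul_of_pos_right (not_le.1 h) (show 0 < Real.log 2 by linarith)
    nlinarith
  linarith

/-- The number of layers enters twice, as the number of amplitude estimations and through the
accuracy required of each; this gives the exponent `2` of the logarithm. -/
theorem query_count_le {k x l T : ℝ} (hk : 0 ≤ k) (hx : 1 ≤ x) (hT0 : 0 ≤ T)
    (hl : k + 2 ≤ 16 * l) (hT : T ≤ 2 * (10000 * ((k + 2) * x))) :
    2 + 2 * ((k + 1) * (2 + T * 4)) ≤ 10 ^ 8 * x * l ^ 2 := by
  have h1 : (k + 2) ^ 2 * x ≤ (16 * l) ^ 2 * x :=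
    mul_le_mul_of_nonneg_right (pow_le_pow_left₀ (by positivity) hl 2) (by linarith)
  have h2 : (k + 1) * T ≤ (k + 2) * (2 * (10000 * ((k + 2) * x))) :=
    mul_le_mul (by linarith) hT hT0 (by positivity)
  have h3 : (k + 2) ^ 2 * 1 ≤ (k + 2) ^ 2 * x := mul_le_mul_of_nonneg_left hx (by positivity)
  have h4 : 2 * (k + 2) ≤ (k + 2) ^ 2 := by nlinarith
  have h5 : 0 ≤ x * l ^ 2 := by positivity
  linarith

end QAMC

end

/-! ### The main theorem -/

theorem mainTheorem2 :
    ∃ (C : ℝ) (m : ℕ), 0 < C ∧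
      ∀ (n c₁ c₂ r : ℕ) (L B M ε Λ : ℝ), 0 ≤ L → 0 ≤ B → 0 ≤ M → 0 < ε →
        Λ = (L + B ^ 2) * (1 + M) →
        (r = 1 ∨ (r = 2 ∧ 1 ≤ Λ)) →
        (∃ A : QAMC.QueryAlgorithm n c₁ c₂,
          (A.nnQueries : ℝ) ≤ C * (1 + Λ / ε) * (1 + Real.log (1 + Λ / ε)) ^ m ∧
          (A.loadQueries : ℝ) ≤ C * (1 + Λ / ε) * (1 + Real.log (1 + Λ / ε)) ^ m ∧
          ∀ (N : QAMC.Network n c₁ c₂) (U : Matrix.unitaryGroup (QAMC.Bits n) ℂ),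
            N.IsLip r L → |N.f 0| ≤ B → N.secondMoment ≤ M →
            N.IsComputedWithin (ε / 2) → QAMC.IsLoader U N.p →
            0.99 ≤ A.outputProb N.code U {w : ℝ | |w - N.mean| ≤ ε}) ∧
        (∀ (N : QAMC.Network n c₁ c₂) (k : ℕ),
            N.IsLip r L → |N.f 0| ≤ B → N.secondMoment ≤ M →
            N.IsComputedWithin (ε / 2) → C * (1 + Λ / ε) ^ 2 ≤ (k : ℝ) →
            0.99 ≤ N.classicalProb k {w : ℝ | |w - N.mean| ≤ ε}) := by
  refine ⟨10 ^ 8, 2, by norm_num, fun n c₁ c₂ r L B M ε Λ hL _ hM hε hΛ hr => ⟨?_, ?_⟩⟩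
  swap
  · intro N k hlip _ hsec hcode hk
    exact QAMC.classical_guarantee N k hL hM hε hΛ hr hlip hsec hcode hk
  have hΛ0 : 0 ≤ Λ := by rw [hΛ]; positivity
  set x := 1 + Λ / ε with hx
  have hx1 : 1 ≤ x := le_add_of_nonneg_right (by positivity)
  have hD : 0 < Λ + ε := by linarith
  have hxε : x * ε = Λ + ε := by rw [hx]; field_simp; ring
  -- Since `x = D/ε` with `D = Λ + ε`, the truncation threshold `2 ^ K * D` is of order `D²/ε`,
  -- which keeps the expected bias below a small multiple of `ε`.
  obtain ⟨K, hK1, hK2⟩ := QAMC.exists_pow_two_mem (x := 6400 * x) (by linarith)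
  have hK0 : (0 : ℝ) ≤ K := K.cast_nonneg
  -- The counter size is proportional to `D/ε` times the factor `K + 2` lost when the layers are
  -- summed.
  obtain ⟨t, ht1, ht2⟩ := QAMC.exists_pow_two_mem (x := 10000 * ((K + 2) * x)) (by nlinarith)
  have hcard : Fintype.card (QAMC.Bits n × QAMC.FixedPoint c₁ c₂) = 2 ^ (n + (1 + (c₁ + c₂))) := by
    simp [pow_add]
  set P := QAMC.meanEstimate [QAMC.Access.load, .nn] [.nn, .loadInv]
    (QAMC.Bits.zero n, QAMC.FixedPoint.zero c₁ c₂) _ hcard (fun b => b.2.value) (Λ + ε) t (K + 1)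
    with hP
  obtain ⟨A, hA1, hA2, hA⟩ := QAMC.exists_queryAlgorithm P
  have hcost : ((QAMC.cost P.steps : ℕ) : ℝ) ≤ 10 ^ 8 * x * (1 + Real.log x) ^ 2 := by
    rw [hP, QAMC.cost_meanEstimate]
    have hlev := QAMC.levels_le hx1 (K := K) (by linarith)
    simp only [List.length_cons, List.length_nil]
    push_cast
    have := QAMC.query_count_le hK0 hx1 (by positivity) hlev ht2
    linarith
  refine ⟨A, le_trans (by exact_mod_cast hA1) hcost, le_trans (by exact_mod_cast hA2) hcost, ?_⟩
  intro N U hlip _ hsec hcode hU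
  rw [hA]
  have hfp := QAMC.flagProb_oracle N.code U N.p_mem.1 hU
  refine QAMC.le_expect_meanEstimate _ _ hcard (QAMC.queryOp_oracle_cancel N.code U) _ hD hε
    (N.f 0) ?_ t K ?_ ?_ ?_ (fun w => Set.indicator_nonneg (fun _ _ => zero_le_one) w) ?_
  · rw [hfp]
    exact N.sum_sq_sub_le hL hM hε hΛ hr hlip hsec hcode
  · rw [← hxε, ← mul_assoc]
    exact mul_le_mul_of_nonneg_right hK1 hε.le
  · rw [← hxε, ← mul_assoc]
    exact mul_le_mul_of_nonneg_right (by linarith) hε.le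
  · rw [← hxε, ← mul_assoc, ← mul_assoc]
    exact mul_le_mul_of_nonneg_right (by linarith) hε.le
  · intro w hw
    rw [hfp] at hw
    rw [Set.indicator_of_mem (show w ∈ {w : ℝ | |w - N.mean| ≤ ε} from N.abs_sub_mean_le hcode hw)]
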